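/- Let $n,m,p$ be positive integers, let $A:\mathbb R^m\to\mathbb R^{n\times n}$ and $B:\mathbb R^m\to\mathbb R^n$ be continuous, let $C\in\mathbb R^{p\times n}$, and let $\lambda:\mathbb R^n\to\mathbb R^m$ be continuous with $\lambda(0)=0$. For a symmetric positive definite $P\in\mathbb R^{n\times n}$ and a function $\alpha:\mathbb R^n\times\mathbb R^p\to[0,\infty)$ consider the system $$ \begin{cases} \dot{\hat x}=A(\lambda(\hat x))\hat x+B(\lambda(\hat x))-\alpha(\hat x,C\varepsilon)\,P^{-1}C^{\top}C\varepsilon,\\ \dot\varepsilon=\bigl(A(\lambda(\hat x))-\alpha(\hat x,C\varepsilon)\,P^{-1}C^{\top}C\bigr)\varepsilon \end{cases}\tag{$*$} $$ with state $(\hat x,\varepsilon)\in\mathbb R^n\times\mathbb R^n$. Suppose that for every constant gain $\alpha>0$, every symmetric positive definite $P$ and every initial condition, $(*)$ has a unique solution on $[0,\infty)$. Suppose moreover: 1. (State feedback stabilizability) $0$ is an asymptotically stable equilibrium point, with basin of attraction a non-empty open set $\mathcal D\subset\mathbb R^n$, of the vector field $x\mapsto A(\lambda(x))x+B(\lambda(x))$.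 2. (Dissipativity) $P\in\mathbb R^{n\times n}$ is a symmetric positive definite matrix such that $x^{\top}PA(\lambda(\hat x))x\le0$ for all $(x,\hat x)\in\mathbb R^n\times\mathcal D$. 3. (Target detectability) The pair $(C,A(0))$ is detectable, i.e. every solution of $\dot\omega=A(0)\omega$ with $C\omega\equiv0$ tends to $0$ as $t\to+\infty$. Then there exists a locally Lipschitz function $\alpha:\mathbb R^n\times\mathbb R^p\to[0,\infty)$, with $\alpha(\hat x,y)>0$ for all $(\hat x,y)\in\mathcal D\times\mathbb R^p$, such that for $(*)$ with this $P$ and this $\alpha$, $(0,0)$ is an asymptotically stable equilibrium point whose basin of attraction contains $\mathcal D\times\mathbb R^n$. (Solutions of $(*)$ with this $\alpha$ are not assumed to be unique: stability is understood for all solutions, and a point belongs to the basin of attraction if all solutions starting from it can be extended to $[0,\infty)$ and all solutions on $[0,\infty)$ starting from it converge to $(0,0)$.) -/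

import Mathlib

open Set Filter Topology
open scoped Matrix

/- The vector spaces are `Fin k → ℝ`; every notion used below (continuity, openness, derivatives
of curves, local Lipschitz continuity, stability, convergence) is independent of the norm. -/

/-- `z` is a (classical) solution of the autonomous equation `z' = F z` on the time interval `I`,
with one-sided derivatives at the end points that belong to `I`. -/
def IsSolutionOn {E : Type*} [NormedAddCommGroup E] [NormedSpace ℝ E]
    (F : E → E) (I : Set ℝ) (z : ℝ → E) : Prop :=
  ∀ t ∈ I, HasDerivWithinAt z (F (z t)) I t

/-- `e` is a (Lyapunov) stable equilibrium point of the vector field `F`: `F e = 0`, and all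
solutions, on any interval `[0, T)`, which start close enough to `e` remain close to `e`. -/
def IsStableEquilibrium {E : Type*} [NormedAddCommGroup E] [NormedSpace ℝ E]
    (F : E → E) (e : E) : Prop :=
  F e = 0 ∧
    ∀ U ∈ 𝓝 e, ∃ V ∈ 𝓝 e, ∀ T : ℝ, 0 < T → ∀ z : ℝ → E,
      IsSolutionOn F (Ico 0 T) z → z 0 ∈ V → ∀ t ∈ Ico 0 T, z t ∈ U

/-- The basin of attraction of `e` for the vector field `F`: the initial conditions from which
there is a solution on `[0, ∞)`, from which every solution on an interval `[0, T)` extends to a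
solution on `[0, ∞)`, and from which all solutions on `[0, ∞)` converge to `e`.
When solutions are unique these are the points whose trajectory is defined for all nonnegative
times and converges to `e`. -/
def basinOfAttraction {E : Type*} [NormedAddCommGroup E] [NormedSpace ℝ E]
    (F : E → E) (e : E) : Set E :=
  {z₀ | (∃ z : ℝ → E, IsSolutionOn F (Ici 0) z ∧ z 0 = z₀) ∧
    (∀ T : ℝ, 0 < T → ∀ z : ℝ → E, IsSolutionOn F (Ico 0 T) z → z 0 = z₀ →
      ∃ w : ℝ → E, IsSolutionOn F (Ici 0) w ∧ EqOn w z (Ico 0 T)) ∧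
    (∀ z : ℝ → E, IsSolutionOn F (Ici 0) z → z 0 = z₀ → Tendsto z atTop (𝓝 e))}

/-- `e` is an asymptotically stable equilibrium point of `F`: it is stable and attracts a
neighborhood of itself. -/
def IsAsymptoticallyStable {E : Type*} [NormedAddCommGroup E] [NormedSpace ℝ E]
    (F : E → E) (e : E) : Prop :=
  IsStableEquilibrium F e ∧ basinOfAttraction F e ∈ 𝓝 e

/-- For every initial condition, `z' = F z` has a unique solution on `[0, ∞)`. -/
def HasUniqueGlobalSolutions {E : Type*} [NormedAddCommGroup E] [NormedSpace ℝ E]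
    (F : E → E) : Prop :=
  ∀ z₀ : E, ∃ z : ℝ → E, (IsSolutionOn F (Ici 0) z ∧ z 0 = z₀) ∧
    ∀ w : ℝ → E, IsSolutionOn F (Ici 0) w → w 0 = z₀ → EqOn w z (Ici 0)

/-- The vector field `x ↦ A(λ(x)) x + B(λ(x))` of the state feedback closed loop
(`lam` is the feedback law `λ`). -/
def feedbackField {n m : ℕ} (A : (Fin m → ℝ) → Matrix (Fin n) (Fin n) ℝ)
    (B : (Fin m → ℝ) → (Fin n → ℝ)) (lam : (Fin n → ℝ) → (Fin m → ℝ))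
    (x : Fin n → ℝ) : Fin n → ℝ :=
  A (lam x) *ᵥ x + B (lam x)

/-- The vector field on pairs `z = (x̂, ε)` of the observer closed loop with gain `α(x̂, Cε)`:
`x̂' = A(λ(x̂)) x̂ + B(λ(x̂)) - α(x̂, Cε) P⁻¹ Cᵀ C ε`,
`ε' = (A(λ(x̂)) - α(x̂, Cε) P⁻¹ Cᵀ C) ε`. -/
noncomputable def observerField {n m p : ℕ} (A : (Fin m → ℝ) → Matrix (Fin n) (Fin n) ℝ)
    (B : (Fin m → ℝ) → (Fin n → ℝ)) (C : Matrix (Fin p) (Fin n) ℝ)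
    (lam : (Fin n → ℝ) → (Fin m → ℝ)) (P : Matrix (Fin n) (Fin n) ℝ)
    (α : (Fin n → ℝ) → (Fin p → ℝ) → ℝ)
    (z : (Fin n → ℝ) × (Fin n → ℝ)) : (Fin n → ℝ) × (Fin n → ℝ) :=
  (A (lam z.1) *ᵥ z.1 + B (lam z.1) - α z.1 (C *ᵥ z.2) • ((P⁻¹ * Cᵀ * C) *ᵥ z.2),
    (A (lam z.1) - α z.1 (C *ᵥ z.2) • (P⁻¹ * Cᵀ * C)) *ᵥ z.2)

/-- The pair `(C, A₀)` is detectable: every solution of `ω' = A₀ ω` with identically zero output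
`C ω` converges to `0`. -/
def IsDetectablePair {n p : ℕ} (C : Matrix (Fin p) (Fin n) ℝ)
    (A₀ : Matrix (Fin n) (Fin n) ℝ) : Prop :=
  ∀ ω : ℝ → (Fin n → ℝ), IsSolutionOn (fun v => A₀ *ᵥ v) (Ici 0) ω →
    (∀ t ∈ Ici (0 : ℝ), C *ᵥ ω t = 0) → Tendsto ω atTop (𝓝 0)

/-! The gain is `β x̂ / (1 + κ * ‖Cε‖)`, where `κ` bounds `P⁻¹ Cᵀ`. The correction term then has
norm at most `β x̂` and also at most `κ * ‖Cε‖`, so the observer state `x̂` is an approximate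
solution of the state feedback loop with either error.

The heart of the proof is that this loop tolerates small persistent errors. No Lyapunov function is
built for it: bounded-speed approximate solutions with vanishing errors converge along an
ultrafilter to exact solutions, and these are unique because the well-posedness assumption covers
the trajectories with `ε = 0`. Hence approximate solutions shadow exact ones on bounded time
intervals (`exists_dist_lt_of_approx`), uniformly over compact sets of initial values
(`exists_tube`), and repeated returns to a neighborhood of `0` make the control last forever
(`mem_of_recurrent`). Doing this along a compact exhaustion of the basin yields a Lipschitz `β`,
positive there, that confines `x̂` to a compact subset (`exists_robust_error_bound`).

Dissipativity now applies at all times, so `V = εᵀPε` decreases at rate at least `2α|Cε|²` and `ε`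
is bounded. Since `V` converges and `Cε` is Lipschitz in time, `Cε → 0`; the correction vanishes and
`x̂ → 0`. A limit of time translates is a solution with `x̂ = 0`, `Cε = 0` and `V` constant, so its
error obeys `ω' = A(0)ω`; detectability forces that constant to be `0`, whence `ε → 0`. Stability
follows because a small `V` keeps `ε`, and with it the correction, small. -/

/-! ### Approximate solutions, their limits, and Peano existence -/

section ApproximateSolutions

variable {E : Type*} [NormedAddCommGroup E] [NormedSpace ℝ E]

/-- `x` satisfies the equation `x' = f x` on `I` up to an error that is at most `g x`. -/
def IsApproxSolOn (f : E → E) (g : E → ℝ) (I : Set ℝ) (x : ℝ → E) : Prop :=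
  ∀ t ∈ I, ∃ v, HasDerivWithinAt x v I t ∧ ‖v - f (x t)‖ ≤ g (x t)

theorem IsApproxSolOn.mono {f : E → E} {g : E → ℝ} {I J : Set ℝ} {x : ℝ → E}
    (h : IsApproxSolOn f g I x) (hJ : J ⊆ I) : IsApproxSolOn f g J x := by
  intro t ht
  obtain ⟨v, hv, hle⟩ := h t (hJ ht)
  exact ⟨v, hv.mono hJ, hle⟩

theorem IsApproxSolOn.mono_error {f : E → E} {g g' : E → ℝ} {I : Set ℝ} {x : ℝ → E}
    (h : IsApproxSolOn f g I x) (hg : ∀ t ∈ I, g (x t) ≤ g' (x t)) : IsApproxSolOn f g' I x := by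
  intro t ht
  obtain ⟨v, hv, hle⟩ := h t ht
  exact ⟨v, hv, hle.trans (hg t ht)⟩

theorem IsSolutionOn.isApproxSolOn {f : E → E} {I : Set ℝ} {x : ℝ → E} (h : IsSolutionOn f I x) :
    IsApproxSolOn f (fun _ => 0) I x :=
  fun t ht => ⟨_, h t ht, by simp⟩

theorem IsApproxSolOn.continuousOn {f : E → E} {g : E → ℝ} {I : Set ℝ} {x : ℝ → E}
    (h : IsApproxSolOn f g I x) : ContinuousOn x I := by
  intro t ht
  obtain ⟨v, hv, -⟩ := h t ht
  exact hv.continuousWithinAt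

theorem IsSolutionOn.continuousOn {f : E → E} {I : Set ℝ} {x : ℝ → E} (h : IsSolutionOn f I x) :
    ContinuousOn x I :=
  fun t ht => (h t ht).continuousWithinAt

theorem IsSolutionOn.mono {f : E → E} {I J : Set ℝ} {x : ℝ → E} (h : IsSolutionOn f I x)
    (hJ : J ⊆ I) : IsSolutionOn f J x :=
  fun t ht => (h t (hJ ht)).mono hJ

theorem HasDerivWithinAt.const_add_comp {x : ℝ → E} {v : E} {a t : ℝ} {I J : Set ℝ}
    (h : HasDerivWithinAt x v I (a + t)) (hJ : MapsTo (fun s => a + s) J I) :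
    HasDerivWithinAt (fun s => x (a + s)) v J t := by
  have := HasDerivWithinAt.scomp t h (((hasDerivAt_id t).const_add a).hasDerivWithinAt (s := J)) hJ
  simpa [Function.comp_def] using this

theorem IsApproxSolOn.shift {f : E → E} {g : E → ℝ} {I J : Set ℝ} {x : ℝ → E} {a : ℝ}
    (h : IsApproxSolOn f g I x) (hJ : MapsTo (fun s => a + s) J I) :
    IsApproxSolOn f g J (fun s => x (a + s)) := by
  intro t ht
  obtain ⟨v, hv, hle⟩ := h (a + t) (hJ ht)
  exact ⟨v, hv.const_add_comp hJ, hle⟩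

theorem IsSolutionOn.shift {f : E → E} {I J : Set ℝ} {x : ℝ → E} {a : ℝ}
    (h : IsSolutionOn f I x) (hJ : MapsTo (fun s => a + s) J I) :
    IsSolutionOn f J (fun s => x (a + s)) :=
  fun t ht => (h (a + t) (hJ ht)).const_add_comp hJ

/-- Concatenation of solutions. -/
theorem IsSolutionOn.concat {f : E → E} {a : ℝ} (ha : 0 ≤ a) {I J : Set ℝ} {x y : ℝ → E}
    (hx : IsSolutionOn f (Icc 0 a) x) (hy : IsSolutionOn f J y) (hI : I ⊆ Ici 0) (h0 : 0 ∈ J)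
    (hJ : ∀ t ∈ I, a ≤ t → t - a ∈ J) (hxy : y 0 = x a) :
    IsSolutionOn f I (fun t => if t ≤ a then x t else y (t - a)) := by
  set z : ℝ → E := fun t => if t ≤ a then x t else y (t - a) with hz
  have hzx : ∀ t, t ≤ a → z t = x t := fun t ht => if_pos ht
  have hzy : ∀ t, a ≤ t → z t = y (t - a) := by
    intro t ht
    rcases ht.eq_or_lt with rfl | h
    · simp [hz, hxy]
    · exact if_neg (not_le.mpr h)
  have h1 : ∀ t ∈ Icc 0 a, HasDerivWithinAt z (f (z t)) (Icc 0 a) t := by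
    intro t ht
    rw [hzx t ht.2]
    exact (hx t ht).congr (fun s hs => hzx s hs.2) (hzx t ht.2)
  have h2 : ∀ t ∈ insert a (I ∩ Ici a), HasDerivWithinAt z (f (z t)) (insert a (I ∩ Ici a)) t := by
    have hm : MapsTo (fun s => -a + s) (insert a (I ∩ Ici a)) J := by
      rintro s (rfl | ⟨hs, hs'⟩)
      · simpa using h0
      · have := hJ s hs hs'
        rwa [sub_eq_neg_add] at this
    have hge : ∀ s ∈ insert a (I ∩ Ici a), a ≤ s := by
      rintro s (rfl | ⟨-, hs⟩)
      exacts [le_rfl, hs]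
    intro t ht
    have h := (hy.shift hm) t ht
    have he : ∀ s ∈ insert a (I ∩ Ici a), z s = y (-a + s) := by
      intro s hs
      rw [hzy s (hge s hs), sub_eq_neg_add]
    rw [he t ht]
    exact h.congr he (he t ht)
  intro t ht
  have ht0 : 0 ≤ t := hI ht
  rcases lt_trichotomy t a with h | h | h
  · refine (h1 t ⟨ht0, h.le⟩).mono_of_mem_nhdsWithin ?_
    filter_upwards [self_mem_nhdsWithin, mem_nhdsWithin_of_mem_nhds (Iio_mem_nhds h)] with s hs hs'
    exact ⟨hI hs, (show s < a from hs').le⟩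
  · have := (h1 t ⟨ht0, h.le⟩).union (h2 t (by simp [h]))
    refine this.mono ?_
    intro s hs
    rcases le_total s a with h' | h'
    · exact Or.inl ⟨hI hs, h'⟩
    · exact Or.inr (Or.inr ⟨hs, h'⟩)
  · refine (h2 t (Or.inr ⟨ht, h.le⟩)).mono_of_mem_nhdsWithin ?_
    filter_upwards [self_mem_nhdsWithin, mem_nhdsWithin_of_mem_nhds (Ioi_mem_nhds h)] with s hs hs'
    exact Or.inr ⟨hs, (show a < s from hs').le⟩

/-- Mean value inequality with speed at most `B + δ`; it supplies the equi-Lipschitz bounds used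
when passing to limits. -/
theorem IsApproxSolOn.norm_sub_le {f : E → E} {δ B : ℝ} {I : Set ℝ} (hI : Convex ℝ I) {x : ℝ → E}
    (h : IsApproxSolOn f (fun _ => δ) I x) (hB : ∀ t ∈ I, ‖f (x t)‖ ≤ B) {s t : ℝ} (hs : s ∈ I)
    (ht : t ∈ I) : ‖x t - x s‖ ≤ (B + δ) * |t - s| := by
  choose! v hv hle using h
  refine hI.norm_image_sub_le_of_norm_hasDerivWithin_le hv (fun r hr => ?_) hs ht
  calc ‖v r‖ = ‖f (x r) + (v r - f (x r))‖ := by congr 1; abel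
    _ ≤ _ := (norm_add_le _ _).trans (add_le_add (hB r hr) (hle r hr))

/-- A pointwise limit of approximate solutions, with errors tending to zero, that are equi-Lipschitz
is a solution. -/
theorem hasDerivWithinAt_of_tendsto_approx {ι : Type*} {l : Filter ι} [l.NeBot] {f : E → E}
    {x : ι → ℝ → E} {y : ℝ → E} {δ : ι → ℝ} {I : Set ℝ} (hI : Convex ℝ I) {L t : ℝ} (ht : t ∈ I)
    (hf : ContinuousAt f (y t)) (hδ : Tendsto δ l (𝓝 0))
    (hx : ∀ᶠ k in l, IsApproxSolOn f (fun _ => δ k) I (x k))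
    (hL : ∀ᶠ k in l, ∀ s ∈ I, ∀ r ∈ I, ‖x k s - x k r‖ ≤ L * |s - r|)
    (hlim : ∀ s ∈ I, Tendsto (fun k => x k s) l (𝓝 (y s))) :
    HasDerivWithinAt y (f (y t)) I t := by
  rw [hasDerivWithinAt_iff_isLittleO, Asymptotics.isLittleO_iff]
  intro c hc
  obtain ⟨r, hr, hfr⟩ := Metric.continuousAt_iff.mp hf (c / 2) (half_pos hc)
  -- Within this time an `L`-Lipschitz curve moves by at most `r / 2`, so every `x k` near its limit
  -- stays where `f` is within `c / 2` of `f (y t)`.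
  have hpos : 0 < r / (2 * (|L| + 1)) := by positivity
  filter_upwards [self_mem_nhdsWithin,
    mem_nhdsWithin_of_mem_nhds (Metric.ball_mem_nhds t hpos)] with s hs hs'
  have hst : |s - t| < r / (2 * (|L| + 1)) := by simpa [Real.dist_eq] using hs'
  have hlim' : Tendsto (fun k => ‖x k s - x k t - (s - t) • f (y t)‖) l
      (𝓝 ‖y s - y t - (s - t) • f (y t)‖) :=
    (((hlim s hs).sub (hlim t ht)).sub_const _).norm
  refine le_of_tendsto hlim' ?_
  have hball : ∀ᶠ k in l, dist (x k t) (y t) < r / 2 :=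
    (hlim t ht).eventually (Metric.ball_mem_nhds _ (half_pos hr))
  have hδ' : ∀ᶠ k in l, δ k < c / 2 := hδ.eventually (Iio_mem_nhds (half_pos hc))
  filter_upwards [hx, hL, hball, hδ'] with k hxk hLk hk hδk
  have hconv : Convex ℝ (I ∩ Metric.closedBall t |s - t|) := hI.inter (convex_closedBall _ _)
  choose! v hv hle using hxk
  have hd : ∀ u ∈ I ∩ Metric.closedBall t |s - t|,
      HasDerivWithinAt (fun u => x k u - u • f (y t)) (v u - f (y t))
        (I ∩ Metric.closedBall t |s - t|) u := by
    intro u hu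
    have h1 := (hv u hu.1).mono (inter_subset_left (t := Metric.closedBall t |s - t|))
    have h2 := ((hasDerivAt_id u).smul_const (f (y t))).hasDerivWithinAt
      (s := I ∩ Metric.closedBall t |s - t|)
    rw [one_smul] at h2
    exact h1.sub h2
  have hbd : ∀ u ∈ I ∩ Metric.closedBall t |s - t|, ‖v u - f (y t)‖ ≤ c := by
    intro u hu
    have hu2 : |u - t| ≤ |s - t| := by simpa [Real.dist_eq] using hu.2
    have hclose : dist (x k u) (y t) < r := by
      have h1 : ‖x k u - x k t‖ ≤ r / 2 := by
        calc ‖x k u - x k t‖ ≤ L * |u - t| := hLk u hu.1 t ht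
          _ ≤ (|L| + 1) * (r / (2 * (|L| + 1))) := by
            apply mul_le_mul _ (hu2.trans hst.le) (abs_nonneg _) (by positivity)
            linarith [le_abs_self L]
          _ = r / 2 := by field_simp
      calc dist (x k u) (y t) ≤ dist (x k u) (x k t) + dist (x k t) (y t) := dist_triangle _ _ _
        _ < r / 2 + r / 2 := by
          rw [dist_eq_norm (x k u)]
          exact add_lt_add_of_le_of_lt h1 hk
        _ = r := by ring
    have h3 := hfr hclose
    rw [dist_eq_norm] at h3
    calc ‖v u - f (y t)‖ = ‖(v u - f (x k u)) + (f (x k u) - f (y t))‖ := by congr 1; abel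
      _ ≤ ‖v u - f (x k u)‖ + ‖f (x k u) - f (y t)‖ := norm_add_le _ _
      _ ≤ c := by linarith [hle u hu.1]
  have := hconv.norm_image_sub_le_of_norm_hasDerivWithin_le hd hbd
    (x := t) (y := s) ⟨ht, by simp⟩ ⟨hs, by simp [Real.dist_eq]⟩
  refine le_of_eq_of_le ?_ this
  congr 1
  rw [sub_smul]; abel

/-- Approximate solutions with errors tending to zero and uniformly bounded velocities converge
along an ultrafilter to a solution. -/
theorem exists_isSolutionOn_of_approx [FiniteDimensional ℝ E] {ι : Type*} (l : Ultrafilter ι)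
    {f : E → E} (hf : Continuous f) {x : ι → ℝ → E} {δ : ι → ℝ} {J : Set ℝ} {R B : ℝ}
    (hJ : ∀ t ∈ J, 0 ≤ t ∧ Icc 0 t ⊆ J ∧ ∃ t₁ ∈ J, t < t₁) (hδ : Tendsto δ l (𝓝 0))
    (h0 : ∀ k, ‖x k 0‖ ≤ R)
    (hx : ∀ t ∈ J, ∀ᶠ k in l, IsApproxSolOn f (fun _ => δ k) (Icc 0 t) (x k) ∧
      ∀ s ∈ Icc 0 t, ‖f (x k s)‖ ≤ B) :
    ∃ y : ℝ → E, (∀ t ∈ J, Tendsto (fun k => x k t) l (𝓝 (y t))) ∧ IsSolutionOn f J y := by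
  have : ProperSpace E := FiniteDimensional.proper ℝ E
  have hδ1 : ∀ᶠ k in l, δ k < 1 := hδ.eventually (Iio_mem_nhds one_pos)
  have hL : ∀ t ∈ J, ∀ᶠ k in l, ∀ s ∈ Icc 0 t, ∀ r ∈ Icc 0 t,
      ‖x k s - x k r‖ ≤ (B + 1) * |s - r| := by
    intro t ht
    filter_upwards [hx t ht, hδ1] with k hk hk1 s hs r hr
    refine (hk.1.norm_sub_le (convex_Icc _ _) hk.2 hr hs).trans ?_
    gcongr
  -- Bounded families converge along an ultrafilter, so pointwise limits exist at all times at once,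
  -- with no extraction of subsequences.
  have hlim : ∀ t, ∃ a, t ∈ J → Tendsto (fun k => x k t) l (𝓝 a) := by
    intro t
    by_cases ht : t ∈ J
    · have hmem : ∀ᶠ k in l, x k t ∈ Metric.closedBall (0 : E) (R + (B + 1) * |t - 0|) := by
        filter_upwards [hL t ht] with k hk
        have h1 := hk t ⟨(hJ t ht).1, le_rfl⟩ 0 ⟨le_rfl, (hJ t ht).1⟩
        rw [mem_closedBall_zero_iff]
        calc ‖x k t‖ = ‖x k 0 + (x k t - x k 0)‖ := by congr 1; abel
          _ ≤ _ := (norm_add_le _ _).trans (add_le_add (h0 k) h1)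
      obtain ⟨a, -, ha⟩ := (isCompact_closedBall (0 : E) _).ultrafilter_le_nhds
        (l.map fun k => x k t) (le_principal_iff.mpr hmem)
      exact ⟨a, fun _ => ha⟩
    · exact ⟨0, fun h => absurd h ht⟩
  choose y hy using hlim
  refine ⟨y, hy, fun t ht => ?_⟩
  obtain ⟨ht0, -, t₁, ht₁, htt⟩ := hJ t ht
  have h := hasDerivWithinAt_of_tendsto_approx (l := (l : Filter ι)) (convex_Icc 0 t₁)
    (t := t) ⟨ht0, htt.le⟩ hf.continuousAt hδ ((hx t₁ ht₁).mono fun k hk => hk.1) (hL t₁ ht₁)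
    (fun s hs => hy s ((hJ t₁ ht₁).2.1 hs))
  refine h.mono_of_mem_nhdsWithin ?_
  filter_upwards [self_mem_nhdsWithin, mem_nhdsWithin_of_mem_nhds (Iio_mem_nhds htt)] with s hs hs'
  exact ⟨(hJ s hs).1, (show s < t₁ from hs').le⟩

/-- This and the next lemma verify the condition `hJ` of `exists_isSolutionOn_of_approx`: the time
domain is open on the right, so the derivative at `t` can be computed in some `Icc 0 t₁` with `t <
t₁`. -/
theorem Ici_zero_forward {t : ℝ} (ht : t ∈ Ici (0 : ℝ)) :
    0 ≤ t ∧ Icc 0 t ⊆ Ici (0 : ℝ) ∧ ∃ t₁ ∈ Ici (0 : ℝ), t < t₁ :=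
  ⟨ht, fun _ hs => hs.1, t + 1, by simp only [mem_Ici] at *; linarith, by linarith⟩

theorem Ico_zero_forward {T t : ℝ} (ht : t ∈ Ico 0 T) :
    0 ≤ t ∧ Icc 0 t ⊆ Ico 0 T ∧ ∃ t₁ ∈ Ico 0 T, t < t₁ :=
  ⟨ht.1, fun _ hs => ⟨hs.1, hs.2.trans_lt ht.2⟩, (t + T) / 2,
    ⟨by linarith [ht.1, ht.2], by linarith [ht.2]⟩, by linarith [ht.2]⟩

theorem tendsto_hyperfilter_atTop : Tendsto (fun k : ℕ => k) (hyperfilter ℕ) atTop :=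
  Nat.hyperfilter_le_atTop

/-- Peano's theorem for bounded uniformly continuous vector fields. -/
theorem exists_isSolutionOn_Ici [FiniteDimensional ℝ E] {F : E → E} (hF : UniformContinuous F)
    {B : ℝ} (hB : ∀ z, ‖F z‖ ≤ B) (z₀ : E) :
    ∃ z : ℝ → E, IsSolutionOn F (Ici 0) z ∧ z 0 = z₀ := by
  have : ProperSpace E := FiniteDimensional.proper ℝ E
  have : CompleteSpace E := FiniteDimensional.complete ℝ E
  have hB0 : 0 ≤ B := (norm_nonneg _).trans (hB z₀)
  have key : ∀ k : ℕ, ∃ x : ℝ → E, x 0 = z₀ ∧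
      IsApproxSolOn F (fun _ => 1 / ((k : ℝ) + 1)) (Icc 0 k) x := by
    intro k
    obtain ⟨G, hG, hGF⟩ := hF.exists_contDiff_dist_le (ε := 1 / ((k : ℝ) + 1)) (by positivity)
    have hG1 : ∀ a, ‖G a - F a‖ ≤ 1 / ((k : ℝ) + 1) := fun a => by
      rw [← dist_eq_norm]; exact (hGF a).le
    have hGB : ∀ a, ‖G a‖ ≤ B + 1 := by
      intro a
      have h1 : 1 / ((k : ℝ) + 1) ≤ 1 := by
        rw [div_le_one (by positivity)]; linarith [(Nat.cast_nonneg k : (0 : ℝ) ≤ k)]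
      calc ‖G a‖ = ‖F a + (G a - F a)‖ := by congr 1; abel
        _ ≤ _ := (norm_add_le _ _).trans (add_le_add (hB a) ((hG1 a).trans h1))
    let L : NNReal := ⟨B + 1, by positivity⟩
    -- A solution of speed at most `L` cannot leave the ball of this radius before time `k`, so
    -- Picard–Lindelöf for the smooth field `G` covers all of `[0, k]`.
    let a : NNReal := L * k
    obtain ⟨K, hK⟩ := (hG.contDiffOn (s := Metric.closedBall z₀ (a : ℝ))).exists_lipschitzOnWith
      (by simp) (convex_closedBall _ _) (isCompact_closedBall _ _)
    have hk0 : (0 : ℝ) ∈ Icc (0 : ℝ) k := ⟨le_rfl, Nat.cast_nonneg k⟩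
    have hpl : IsPicardLindelof (fun _ => G) (⟨0, hk0⟩ : Icc (0 : ℝ) k) z₀ a 0 L K :=
      IsPicardLindelof.of_time_independent (fun x _ => hGB x) hK (by simp [a])
    obtain ⟨x, hx0, hx⟩ := hpl.exists_eq_forall_mem_Icc_hasDerivWithinAt₀
    exact ⟨x, hx0, fun t ht => ⟨_, hx t ht, hG1 _⟩⟩
  choose x hx0 hx using key
  obtain ⟨y, hy, hsol⟩ := exists_isSolutionOn_of_approx (hyperfilter ℕ) hF.continuous (x := x)
    (δ := fun k => 1 / ((k : ℝ) + 1)) (J := Ici 0) (R := ‖z₀‖) (B := B)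
    (fun t ht => Ici_zero_forward ht)
    (tendsto_one_div_add_atTop_nhds_zero_nat.comp tendsto_hyperfilter_atTop)
    (fun k => by rw [hx0]) (by
      intro t _
      have h1 : ∀ᶠ k : ℕ in atTop, t ≤ k := by
        filter_upwards [eventually_ge_atTop ⌈t⌉₊] with k hk
        exact (Nat.le_ceil t).trans (by exact_mod_cast hk)
      filter_upwards [tendsto_hyperfilter_atTop.eventually h1] with k hk
      exact ⟨(hx k).mono (Icc_subset_Icc_right hk), fun s _ => hB _⟩)
  refine ⟨y, hsol, tendsto_nhds_unique (hy 0 (by simp)) ?_⟩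
  simp only [hx0]
  exact tendsto_const_nhds

/-- Solutions of a bounded uniformly continuous vector field extend to all nonnegative times. -/
theorem exists_extension_Ici [FiniteDimensional ℝ E] {F : E → E} (hF : UniformContinuous F)
    {B : ℝ} (hB : ∀ z, ‖F z‖ ≤ B) {T : ℝ} (hT : 0 < T) {z : ℝ → E}
    (hz : IsSolutionOn F (Ico 0 T) z) :
    ∃ w : ℝ → E, IsSolutionOn F (Ici 0) w ∧ EqOn w z (Ico 0 T) := by
  -- The value `z T` carries no information. Restarting from `z (s k)` with `s k → T` gives global
  -- solutions agreeing with `z` on longer and longer intervals, and their limit is the extension.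
  let s : ℕ → ℝ := fun k => T - T * (1 / ((k : ℝ) + 1))
  have hs0 : ∀ k, 0 ≤ s k := by
    intro k
    have h1 : 1 / ((k : ℝ) + 1) ≤ 1 := by
      rw [div_le_one (by positivity)]; linarith [(Nat.cast_nonneg k : (0 : ℝ) ≤ k)]
    simp only [s]; nlinarith
  have hsT : ∀ k, s k < T := by
    intro k
    have : 0 < T * (1 / ((k : ℝ) + 1)) := by positivity
    simp only [s]; linarith
  have hslim : Tendsto s atTop (𝓝 T) := by
    have := (tendsto_one_div_add_atTop_nhds_zero_nat (𝕜 := ℝ)).const_mul T |>.const_sub T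
    simpa [s] using this
  have key : ∀ k : ℕ, ∃ x : ℝ → E, IsSolutionOn F (Ici 0) x ∧ ∀ t, t ≤ s k → x t = z t := by
    intro k
    obtain ⟨y, hy, hy0⟩ := exists_isSolutionOn_Ici hF hB (z (s k))
    refine ⟨_, IsSolutionOn.concat (hs0 k) (hz.mono fun t ht => ⟨ht.1, ht.2.trans_lt (hsT k)⟩) hy
      subset_rfl (by simp) (fun t _ hat => by simpa using hat) hy0, fun t ht => if_pos ht⟩
  choose x hx hxz using key
  obtain ⟨y, hy, hsol⟩ := exists_isSolutionOn_of_approx (hyperfilter ℕ) hF.continuous (x := x)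
    (δ := fun _ => 0) (J := Ici 0) (R := ‖z 0‖) (B := B)
    (fun t ht => Ici_zero_forward ht) tendsto_const_nhds
    (fun k => by rw [hxz k 0 (hs0 k)]) (by
      intro t _
      exact Eventually.of_forall fun k =>
        ⟨(hx k).isApproxSolOn.mono Icc_subset_Ici_self, fun s _ => hB _⟩)
  refine ⟨y, hsol, fun t ht => tendsto_nhds_unique (hy t ht.1) ?_⟩
  have h1 : ∀ᶠ k in hyperfilter ℕ, t < s k :=
    tendsto_hyperfilter_atTop.eventually (hslim.eventually (Ioi_mem_nhds ht.2))
  exact tendsto_const_nhds.congr' (h1.mono fun k hk => (hxz k t (le_of_lt hk)).symm)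

end ApproximateSolutions

/-! ### Robustness of asymptotic stability under persistent errors -/

section Robustness

variable {E : Type*} [NormedAddCommGroup E] [NormedSpace ℝ E]

/-- Solutions of `x' = f x` on `[0, ∞)` are determined by their initial value. -/
def HasForwardUniqueness (f : E → E) : Prop :=
  ∀ x y : ℝ → E, IsSolutionOn f (Ici 0) x → IsSolutionOn f (Ici 0) y → x 0 = y 0 →
    EqOn x y (Ici 0)

/-- A solution from `z a`, preceded by `z` on `[0, a]`, is a solution from `z 0`, to which the
clauses of the basin apply; uniqueness is not needed. -/
theorem basinOfAttraction_forward_invariant {f : E → E} {e : E} {z : ℝ → E}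
    (hz : IsSolutionOn f (Ici 0) z) (h0 : z 0 ∈ basinOfAttraction f e) {a : ℝ} (ha : 0 ≤ a) :
    z a ∈ basinOfAttraction f e := by
  obtain ⟨-, hext, hconv⟩ := h0
  refine ⟨⟨fun t => z (a + t), hz.shift fun t ht => ?_, by simp⟩, ?_, ?_⟩
  · simp only [mem_Ici] at *; linarith
  · intro T hT y hy hy0
    have hc := IsSolutionOn.concat ha (hz.mono Icc_subset_Ici_self) hy
      (I := Ico 0 (a + T)) (fun t ht => ht.1) (by simp [hT])
      (fun t ht hat => ⟨by linarith, by linarith [ht.2]⟩) hy0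
    obtain ⟨w, hw, hwz⟩ := hext (a + T) (by linarith) _ hc (by simp [ha])
    refine ⟨fun t => w (a + t), hw.shift fun t ht => ?_, fun t ht => ?_⟩
    · simp only [mem_Ici] at *; linarith
    · simp only
      rw [hwz ⟨by linarith [ht.1], by linarith [ht.2]⟩]
      rcases ht.1.eq_or_lt with h | h
      · simp [← h, hy0]
      · simp [h]
  · intro y hy hy0
    have hc := IsSolutionOn.concat ha (hz.mono Icc_subset_Ici_self) hy
      (I := Ici 0) subset_rfl (by simp) (fun t ht hat => by simpa using hat) hy0
    have hlim := hconv _ hc (by simp [ha])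
    have h2 := hlim.comp (tendsto_atTop_add_const_left atTop a tendsto_id)
    refine h2.congr' ?_
    filter_upwards [eventually_gt_atTop 0] with t ht
    simp [ht]

/-- On a bounded time interval, approximate solutions with small errors remain close to the
solution with the same initial value. -/
theorem exists_dist_lt_of_approx [FiniteDimensional ℝ E] {f : E → E} (hf : Continuous f) {e : E}
    (hu : HasForwardUniqueness f) {z : ℝ → E} (hz : IsSolutionOn f (Ici 0) z)
    (h0 : z 0 ∈ basinOfAttraction f e) (T : ℝ) {η : ℝ} (hη : 0 < η) :
    ∃ δ > 0, ∀ S ∈ Icc 0 T, ∀ x : ℝ → E, dist (x 0) (z 0) < δ →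
      IsApproxSolOn f (fun _ => δ) (Icc 0 S) x → dist (x S) (z S) < η := by
  have : ProperSpace E := FiniteDimensional.proper ℝ E
  by_contra! hcon
  -- The minimum with `η` makes the initial distance less than `η`, so the first time `s` at which
  -- the distance reaches `η` is positive.
  let δ : ℕ → ℝ := fun k => min (1 / ((k : ℝ) + 1)) η
  have hδpos : ∀ k, 0 < δ k := fun k => lt_min (by positivity) hη
  have hδlim : Tendsto δ (hyperfilter ℕ) (𝓝 0) := by
    have h := ((tendsto_one_div_add_atTop_nhds_zero_nat (𝕜 := ℝ)).min
      (tendsto_const_nhds (x := η))).comp tendsto_hyperfilter_atTop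
    simpa [min_eq_left hη.le, δ, Function.comp_def] using h
  have hzc : ContinuousOn z (Ici 0) := hz.continuousOn
  have key : ∀ k : ℕ, ∃ s ∈ Ioc 0 T, ∃ x : ℝ → E, dist (x 0) (z 0) < δ k ∧
      IsApproxSolOn f (fun _ => δ k) (Icc 0 s) x ∧ η ≤ dist (x s) (z s) ∧
      ∀ t ∈ Icc 0 s, dist (x t) (z t) ≤ η := by
    intro k
    obtain ⟨S, hS, x, hx0, hx, hge⟩ := hcon (δ k) (hδpos k)
    have hg : ContinuousOn (fun t => dist (x t) (z t)) (Icc 0 S) :=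
      continuous_dist.comp_continuousOn
        (hx.continuousOn.prodMk (hzc.mono Icc_subset_Ici_self))
    have hcl := hg.preimage_isClosed_of_isClosed isClosed_Icc (isClosed_Ici (a := η))
    obtain ⟨s, ⟨hs, hsη⟩, hmin⟩ := (isCompact_Icc.of_isClosed_subset hcl
      inter_subset_left).exists_isLeast ⟨S, ⟨hS.1, le_rfl⟩, hge⟩
    have hsη' : η ≤ dist (x s) (z s) := hsη
    have hs0 : 0 < s := by
      rcases hs.1.eq_or_lt with h | h
      · rw [← h] at hsη'
        exact absurd (hx0.trans_le (min_le_right _ _)) (not_lt.mpr hsη')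
      · exact h
    refine ⟨s, ⟨hs0, hs.2.trans hS.2⟩, x, hx0, hx.mono (Icc_subset_Icc_right hs.2), hsη', ?_⟩
    have hcl2 := (hg.mono (Icc_subset_Icc_right hs.2)).preimage_isClosed_of_isClosed isClosed_Icc
      (isClosed_Iic (a := η))
    have hsub : Ico 0 s ⊆ Icc 0 s ∩ (fun t => dist (x t) (z t)) ⁻¹' Iic η := by
      intro t ht
      refine ⟨⟨ht.1, ht.2.le⟩, ?_⟩
      by_contra hlt
      have hlt' : η < dist (x t) (z t) := not_le.mp hlt
      exact absurd (hmin ⟨⟨ht.1, ht.2.le.trans hs.2⟩, hlt'.le⟩) (not_le.mpr ht.2)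
    have hcc := closure_minimal hsub hcl2
    rw [closure_Ico hs0.ne] at hcc
    exact fun t ht => (hcc ht).2
  choose s hs x hx0 hx hge hle using key
  obtain ⟨R, hR⟩ := ((isCompact_Icc (a := (0 : ℝ)) (b := T)).image_of_continuousOn
    (hzc.mono Icc_subset_Ici_self)).isBounded.exists_norm_le
  obtain ⟨B, hB⟩ := ((isCompact_closedBall (0 : E) (R + η)).image hf).isBounded.exists_norm_le
  have hxR : ∀ k, ∀ t ∈ Icc 0 (s k), ‖f (x k t)‖ ≤ B := by
    intro k t ht
    refine hB _ ⟨_, ?_, rfl⟩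
    rw [mem_closedBall_zero_iff]
    calc ‖x k t‖ = ‖z t + (x k t - z t)‖ := by congr 1; abel
      _ ≤ R + η := (norm_add_le _ _).trans (add_le_add
        (hR _ ⟨t, ⟨ht.1, ht.2.trans (hs k).2⟩, rfl⟩) (by rw [← dist_eq_norm]; exact hle k t ht))
  obtain ⟨s', hs', hslim⟩ := (isCompact_Icc (a := (0 : ℝ)) (b := T)).ultrafilter_le_nhds
    ((hyperfilter ℕ).map s) (le_principal_iff.mpr
      (Eventually.of_forall fun k => ⟨(hs k).1.le, (hs k).2⟩ : ∀ᶠ k in hyperfilter ℕ, s k ∈ Icc 0 T))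
  replace hslim : Tendsto s (hyperfilter ℕ) (𝓝 s') := hslim
  have hx0lim : Tendsto (fun k => x k 0) (hyperfilter ℕ) (𝓝 (z 0)) :=
    tendsto_iff_dist_tendsto_zero.mpr
      (squeeze_zero (fun _ => dist_nonneg) (fun k => (hx0 k).le) hδlim)
  have hlim : ∀ t ∈ Ico 0 s', Tendsto (fun k => x k t) (hyperfilter ℕ) (𝓝 (z t)) := by
    intro t ht
    have hs'0 : 0 < s' := ht.1.trans_lt ht.2
    obtain ⟨y, hy, hsol⟩ := exists_isSolutionOn_of_approx (hyperfilter ℕ) hf (x := x)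
      (J := Ico 0 s') (R := R + η) (B := B) (fun t ht => Ico_zero_forward ht) hδlim
      (fun k => by
        calc ‖x k 0‖ = ‖z 0 + (x k 0 - z 0)‖ := by congr 1; abel
          _ ≤ R + η := (norm_add_le _ _).trans (add_le_add
            (hR _ ⟨0, ⟨le_rfl, (hs k).1.le.trans (hs k).2⟩, rfl⟩)
            (by rw [← dist_eq_norm]; exact hle k 0 ⟨le_rfl, (hs k).1.le⟩)))
      (fun t ht => by
        filter_upwards [hslim.eventually (Ioi_mem_nhds ht.2)] with k hk
        have hk' : t ≤ s k := le_of_lt hk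
        exact ⟨(hx k).mono (Icc_subset_Icc_right hk'),
          fun r hr => hxR k r ⟨hr.1, hr.2.trans hk'⟩⟩)
    have hy0 : y 0 = z 0 := tendsto_nhds_unique (hy 0 ⟨le_rfl, hs'0⟩) hx0lim
    -- Uniqueness concerns solutions on `[0, ∞)`, so the limit `y` on `[0, s')` must first be
    -- extended; membership of `z 0` in the basin allows this.
    obtain ⟨w, hw, hwy⟩ := h0.2.1 s' hs'0 y hsol hy0
    have hwz := hu w z hw hz (by rw [hwy ⟨le_rfl, hs'0⟩, hy0])
    rw [← hwz ht.1, hwy ht]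
    exact hy t ht
  have hzs : Tendsto (fun k => z (s k)) (hyperfilter ℕ) (𝓝 (z s')) :=
    (hzc s' hs'.1).tendsto.comp (tendsto_nhdsWithin_iff.mpr
      ⟨hslim, Eventually.of_forall fun k => (hs k).1.le⟩)
  -- Speeds are at most `B + 1`, so the deviation `η` at time `s k` is nearly present at an earlier
  -- time `t`, where the deviation tends to zero. Taking `t` up to `s'` contradicts `0 < η`.
  have hest : ∀ t, 0 ≤ t → Tendsto (fun k => x k t) (hyperfilter ℕ) (𝓝 (z t)) →
      (∀ᶠ k in hyperfilter ℕ, t ≤ s k) → η ≤ (B + 1) * |s' - t| + dist (z t) (z s') := by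
    intro t ht0 ht hts
    have hl : Tendsto (fun k => (B + 1) * |s k - t| + dist (x k t) (z t) + dist (z t) (z (s k)))
        (hyperfilter ℕ) (𝓝 ((B + 1) * |s' - t| + dist (z t) (z t) + dist (z t) (z s'))) :=
      ((((hslim.sub_const t).abs).const_mul _).add (ht.dist tendsto_const_nhds)).add
        (tendsto_const_nhds.dist hzs)
    rw [dist_self, add_zero] at hl
    refine ge_of_tendsto hl ?_
    have hδ1 : ∀ᶠ k in hyperfilter ℕ, δ k < 1 := hδlim.eventually (Iio_mem_nhds one_pos)
    filter_upwards [hts, hδ1] with k hk hk1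
    have h1 := (hx k).norm_sub_le (convex_Icc _ _) (hxR k) ⟨ht0, hk⟩ ⟨(hs k).1.le, le_rfl⟩
    have h2 : ‖x k (s k) - x k t‖ ≤ (B + 1) * |s k - t| := by
      refine h1.trans ?_
      gcongr
    rw [← dist_eq_norm] at h2
    linarith [hge k, dist_triangle4 (x k (s k)) (x k t) (z t) (z (s k))]
  rcases hs'.1.eq_or_lt with h | h
  · have := hest 0 le_rfl hx0lim (Eventually.of_forall fun k => (hs k).1.le)
    simp [← h] at this
    linarith
  · have hl : Tendsto (fun t => (B + 1) * |s' - t| + dist (z t) (z s')) (𝓝[<] s')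
        (𝓝 ((B + 1) * |s' - s'| + dist (z s') (z s'))) := by
      have hzt : Tendsto z (𝓝[<] s') (𝓝 (z s')) :=
        ((hzc s' hs'.1).continuousAt (Ici_mem_nhds h)).tendsto.mono_left nhdsWithin_le_nhds
      have ht : Tendsto (fun t : ℝ => t) (𝓝[<] s') (𝓝 s') :=
        tendsto_id.mono_left nhdsWithin_le_nhds
      exact (((ht.const_sub s').abs).const_mul _).add (hzt.dist tendsto_const_nhds)
    have := ge_of_tendsto hl (b := η) (by
      filter_upwards [self_mem_nhdsWithin, mem_nhdsWithin_of_mem_nhds (Ioi_mem_nhds h)] with t ht ht0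
      have ht0' : 0 ≤ t := le_of_lt ht0
      exact hest t ht0' (hlim t ⟨ht0', ht⟩)
        ((hslim.eventually (Ioi_mem_nhds ht)).mono fun k hk => le_of_lt hk))
    simp at this
    linarith

/-- Approximate solutions that start in a compact subset `K` of the basin of attraction reach a
prescribed neighborhood of the equilibrium in bounded time, and remain until then in a compact
subset of any open set that contains the trajectories of `K`. -/
theorem exists_tube [FiniteDimensional ℝ E] {f : E → E} (hf : Continuous f) {e : E}
    (hu : HasForwardUniqueness f) {K W U : Set E} (hK : IsCompact K)
    (hKD : K ⊆ basinOfAttraction f e) (hW : IsOpen W)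
    (hKW : ∀ z, IsSolutionOn f (Ici 0) z → z 0 ∈ K → ∀ t, 0 ≤ t → z t ∈ W) (hU : U ∈ 𝓝 e) :
    ∃ R ⊆ W, IsCompact R ∧ ∃ δ > 0, ∃ T : ℝ, ∀ x₀ ∈ K, ∃ τ ∈ Icc 1 T, ∀ x : ℝ → E, x 0 = x₀ →
      ∀ b, 0 ≤ b → IsApproxSolOn f (fun _ => δ) (Icc 0 b) x →
        (b ≤ τ → x b ∈ R) ∧ (b = τ → x b ∈ U) := by
  have : ProperSpace E := FiniteDimensional.proper ℝ E
  -- Compactness induction: unions combine tubes and take the smaller error, leaving only a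
  -- neighborhood of one point, where the trajectory of that point is shadowed.
  refine hK.induction_on (p := fun K => ∃ R ⊆ W, IsCompact R ∧ ∃ δ > 0, ∃ T : ℝ, ∀ x₀ ∈ K,
    ∃ τ ∈ Icc 1 T, ∀ x : ℝ → E, x 0 = x₀ → ∀ b, 0 ≤ b → IsApproxSolOn f (fun _ => δ) (Icc 0 b) x →
        (b ≤ τ → x b ∈ R) ∧ (b = τ → x b ∈ U)) ?_ ?_ ?_ ?_
  · exact ⟨∅, empty_subset _, isCompact_empty, 1, one_pos, 1, by simp⟩
  · rintro s t hst ⟨R, hRW, hR, δ, hδ, T, h⟩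
    exact ⟨R, hRW, hR, δ, hδ, T, fun x₀ hx₀ => h x₀ (hst hx₀)⟩
  · rintro s t ⟨R, hRW, hR, δ, hδ, T, h⟩ ⟨R', hRW', hR', δ', hδ', T', h'⟩
    refine ⟨R ∪ R', union_subset hRW hRW', hR.union hR', min δ δ', lt_min hδ hδ', max T T', ?_⟩
    rintro x₀ (hx₀ | hx₀)
    · obtain ⟨τ, hτ, H⟩ := h x₀ hx₀
      refine ⟨τ, ⟨hτ.1, hτ.2.trans (le_max_left _ _)⟩, fun x hx b hb hxb => ?_⟩
      obtain ⟨h1, h2⟩ := H x hx b hb (hxb.mono_error fun _ _ => min_le_left _ _)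
      exact ⟨fun hh => Or.inl (h1 hh), h2⟩
    · obtain ⟨τ, hτ, H⟩ := h' x₀ hx₀
      refine ⟨τ, ⟨hτ.1, hτ.2.trans (le_max_right _ _)⟩, fun x hx b hb hxb => ?_⟩
      obtain ⟨h1, h2⟩ := H x hx b hb (hxb.mono_error fun _ _ => min_le_right _ _)
      exact ⟨fun hh => Or.inr (h1 hh), h2⟩
  · intro z₀ hz₀
    obtain ⟨z, hz, rfl⟩ := (hKD hz₀).1
    have hzlim := (hKD hz₀).2.2 z hz rfl
    obtain ⟨T, hT1, hTU⟩ := ((eventually_ge_atTop (1 : ℝ)).and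
      (hzlim.eventually (eventually_mem_nhds_iff.mpr hU))).exists
    obtain ⟨η₁, hη₁, hball⟩ := Metric.mem_nhds_iff.mp hTU
    have hcpt : IsCompact (z '' Icc 0 T) :=
      isCompact_Icc.image_of_continuousOn (hz.continuousOn.mono Icc_subset_Ici_self)
    obtain ⟨η₂, hη₂, hthick⟩ := hcpt.exists_cthickening_subset_open hW (by
      rintro _ ⟨t, ht, rfl⟩
      exact hKW z hz hz₀ t ht.1)
    obtain ⟨δ, hδ, H⟩ := exists_dist_lt_of_approx hf hu hz (hKD hz₀) T (lt_min hη₁ hη₂)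
    refine ⟨Metric.ball (z 0) δ, mem_nhdsWithin_of_mem_nhds (Metric.ball_mem_nhds _ hδ),
      _, hthick, hcpt.cthickening, δ, hδ, T, fun x₀ hx₀ => ⟨T, ⟨hT1, le_rfl⟩, ?_⟩⟩
    rintro x rfl b hb hxb
    refine ⟨fun hbT => ?_, ?_⟩
    · have := H b ⟨hb, hbT⟩ x hx₀ hxb
      exact Metric.mem_cthickening_of_dist_le (x b) (z b) η₂ _ ⟨b, ⟨hb, hbT⟩, rfl⟩
        (this.le.trans (min_le_right _ _))
    · rintro rfl
      exact hball ((H b ⟨hb, le_rfl⟩ x hx₀ hxb).trans_le (min_le_left _ _))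

/-- If approximate solutions starting in `K` return to `K` after a time at least `1` and remain in
`R` until then, they remain in `R` forever. -/
theorem mem_of_recurrent {f : E → E} {δ : ℝ} {K R : Set E}
    (h : ∀ x₀ ∈ K, ∃ τ : ℝ, 1 ≤ τ ∧ ∀ x : ℝ → E, x 0 = x₀ → ∀ b, 0 ≤ b →
      IsApproxSolOn f (fun _ => δ) (Icc 0 b) x → (b ≤ τ → x b ∈ R) ∧ (b = τ → x b ∈ K))
    {x : ℝ → E} {b : ℝ} (hb : 0 ≤ b) (hx : IsApproxSolOn f (fun _ => δ) (Icc 0 b) x)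
    (hx0 : x 0 ∈ K) : x b ∈ R := by
  -- Each return takes time at least `1`, so induction on an integer bound for `b` terminates.
  obtain ⟨N, hN⟩ := exists_nat_ge b
  induction N generalizing x b with
  | zero =>
    obtain ⟨τ, hτ, H⟩ := h _ hx0
    exact (H x rfl b hb hx).1 (hN.trans (by simpa using zero_le_one.trans hτ))
  | succ N ih =>
    obtain ⟨τ, hτ, H⟩ := h _ hx0
    rcases le_total b τ with hbτ | hbτ
    · exact (H x rfl b hb hx).1 hbτ
    · have hτ0 : 0 ≤ τ := zero_le_one.trans hτ
      have h1 := (H x rfl τ hτ0 (hx.mono (Icc_subset_Icc_right hbτ))).2 rfl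
      have h2 := ih (x := fun t => x (τ + t)) (b := b - τ) (by linarith)
        (hx.shift fun t ht => ⟨by linarith [ht.1], by linarith [ht.2]⟩) (by simpa using h1)
        (by push_cast at hN; linarith)
      simpa using h2

/-- Stability under small persistent perturbations. -/
theorem exists_stable_of_approx [FiniteDimensional ℝ E] {f : E → E} (hf : Continuous f) {e : E}
    (hu : HasForwardUniqueness f) (hs : IsAsymptoticallyStable f e) {U : Set E} (hU : U ∈ 𝓝 e) :
    ∃ K ∈ 𝓝 e, ∃ δ > 0, ∀ x : ℝ → E, ∀ b, 0 ≤ b → IsApproxSolOn f (fun _ => δ) (Icc 0 b) x →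
      x 0 ∈ K → x b ∈ U := by
  have : ProperSpace E := FiniteDimensional.proper ℝ E
  obtain ⟨V, hV, hVU⟩ := hs.1.2 (interior U) (interior_mem_nhds.mpr hU)
  obtain ⟨r, hr, hball⟩ := Metric.nhds_basis_closedBall.mem_iff.mp (inter_mem hV hs.2)
  obtain ⟨R, hRU, -, δ, hδ, T, H⟩ := exists_tube hf hu (isCompact_closedBall e r)
    (fun y hy => (hball hy).2) isOpen_interior (fun z hz hz0 t ht =>
      hVU (t + 1) (by linarith) z (hz.mono Ico_subset_Ici_self) (hball hz0).1 t
        ⟨ht, by linarith⟩) (Metric.closedBall_mem_nhds e hr)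
  refine ⟨_, Metric.closedBall_mem_nhds e hr, δ, hδ, fun x b hb hx hx0 => ?_⟩
  refine interior_subset (hRU (mem_of_recurrent (fun x₀ hx₀ => ?_) hb hx hx0))
  obtain ⟨τ, hτ, H'⟩ := H x₀ hx₀
  exact ⟨τ, hτ.1, H'⟩

/-- Uniform attraction of compact subsets of the basin under small persistent perturbations. -/
theorem exists_attraction_of_approx [FiniteDimensional ℝ E] {f : E → E} (hf : Continuous f) {e : E}
    (hu : HasForwardUniqueness f) (hs : IsAsymptoticallyStable f e) {K U : Set E}
    (hK : IsCompact K) (hKD : K ⊆ basinOfAttraction f e) (hU : U ∈ 𝓝 e) :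
    ∃ δ > 0, ∃ T : ℝ, 0 ≤ T ∧ ∀ x : ℝ → E, ∀ b, T ≤ b →
      IsApproxSolOn f (fun _ => δ) (Icc 0 b) x → x 0 ∈ K → x b ∈ U := by
  obtain ⟨V, hV, δ, hδ, H⟩ := exists_stable_of_approx hf hu hs hU
  obtain ⟨R, -, -, δ', hδ', T, H'⟩ := exists_tube hf hu hK hKD isOpen_univ
    (fun _ _ _ _ _ => mem_univ _) hV
  refine ⟨min δ δ', lt_min hδ hδ', max T 0, le_max_right _ _, fun x b hb hx hx0 => ?_⟩
  obtain ⟨τ, hτ, h⟩ := H' _ hx0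
  have hτ0 : 0 ≤ τ := zero_le_one.trans hτ.1
  have hτb : τ ≤ b := hτ.2.trans ((le_max_left _ _).trans hb)
  have h1 := (h x rfl τ hτ0 ((hx.mono (Icc_subset_Icc_right hτb)).mono_error
    fun _ _ => min_le_right _ _)).2 rfl
  have h2 := H (fun t => x (τ + t)) (b - τ) (by linarith) ((hx.shift fun t ht =>
    ⟨by linarith [ht.1], by linarith [ht.2]⟩).mono_error fun _ _ => min_le_left _ _)
    (by simpa using h1)
  simpa using h2

/-- A function that is locally bounded below by positive constants on the open set `D` has a
Lipschitz minorant that is positive on `D`. -/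
theorem exists_lipschitz_minorant {X : Type*} [PseudoMetricSpace X] {D : Set X} {g : X → ℝ}
    (hg0 : ∀ x, 0 ≤ g x) (hg : ∀ x ∈ D, ∃ c > 0, ∀ᶠ y in 𝓝 x, c ≤ g y) :
    ∃ β : X → ℝ, LipschitzWith 1 β ∧ (∀ x, 0 ≤ β x) ∧ (∀ x, β x ≤ g x) ∧ ∀ x ∈ D, 0 < β x := by
  -- `S` is the graph of `g`, and the minorant at `x` is the distance from `(x, 0)` to it. It is
  -- positive on `D` since a graph point is either horizontally far from `x` or at height at least
  -- `c`.
  let S : Set (X × ℝ) := range fun x => (x, g x)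
  refine ⟨fun x => Metric.infDist (x, (0 : ℝ)) S, ?_, fun x => Metric.infDist_nonneg,
    fun x => ?_, fun x hx => ?_⟩
  · refine LipschitzWith.of_dist_le_mul fun x y => ?_
    have := (Metric.lipschitz_infDist_pt S).dist_le_mul (x, (0 : ℝ)) (y, 0)
    simpa [Prod.dist_eq] using this
  · refine (Metric.infDist_le_dist_of_mem (mem_range_self x)).trans ?_
    simp [Prod.dist_eq, abs_of_nonneg (hg0 x), hg0 x]
  · have hne : S.Nonempty := ⟨_, mem_range_self x⟩
    obtain ⟨c, hc, hcx⟩ := hg x hx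
    obtain ⟨r, hr, hball⟩ := Metric.eventually_nhds_iff.mp hcx
    refine (lt_min hr hc).trans_le ((Metric.le_infDist hne).mpr ?_)
    rintro _ ⟨y, rfl⟩
    rw [Prod.dist_eq]
    by_cases hy : dist y x < r
    · refine (min_le_right _ _).trans ((hball hy).trans ((le_abs_self _).trans ?_))
      simp [abs_of_nonneg (hg0 y)]
    · refine (min_le_left _ _).trans ((not_lt.mp hy).trans ?_)
      simp [dist_comm x y]

/-- The open set `D` is locally compact, so its subtype has an exhaustion; dropping its first `j₀`
members makes the initial set a neighborhood of `e`. -/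
theorem exists_compact_exhaustion [FiniteDimensional ℝ E] {D : Set E} (hD : IsOpen D) {e : E}
    (he : e ∈ D) : ∃ K : ℕ → Set E, (∀ j, IsCompact (K j)) ∧ (∀ j, K j ⊆ D) ∧ Monotone K ∧
      K 0 ∈ 𝓝 e ∧ ∀ x ∈ D, ∃ j, K j ∈ 𝓝 x := by
  have : ProperSpace E := FiniteDimensional.proper ℝ E
  have : LocallyCompactSpace D := hD.locallyCompactSpace
  let K := CompactExhaustion.choice D
  have hn : ∀ x : D, ∀ j, K j ∈ 𝓝 x → (Subtype.val '' K j) ∈ 𝓝 (x : E) := fun x j h =>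
    hD.isOpenMap_subtype_val.image_mem_nhds h
  obtain ⟨j₀, hj₀⟩ := K.exists_mem_nhds ⟨e, he⟩
  refine ⟨fun j => Subtype.val '' K (j₀ + j), fun j => (K.isCompact _).image continuous_subtype_val,
    fun j => ?_, fun i j hij => image_mono (K.subset (by omega)), hn _ _ hj₀, fun x hx => ?_⟩
  · rintro _ ⟨y, -, rfl⟩
    exact y.2
  · obtain ⟨j, hj⟩ := K.exists_mem_nhds ⟨x, hx⟩
    exact ⟨j, hn ⟨x, hx⟩ _ (mem_of_superset hj (K.subset (by omega)))⟩

/-- The basin of attraction is robustly invariant: there is a Lipschitz error bound, positive on the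
basin, such that approximate solutions with this error bound remain in compact subsets of the
basin. -/
theorem exists_robust_error_bound [FiniteDimensional ℝ E] {f : E → E} (hf : Continuous f) {e : E}
    (hu : HasForwardUniqueness f) (hs : IsAsymptoticallyStable f e)
    (hD : IsOpen (basinOfAttraction f e)) :
    ∃ β : E → ℝ, LipschitzWith 1 β ∧ (∀ x, 0 ≤ β x) ∧ (∀ x, β x ≤ 1) ∧
      (∀ x ∈ basinOfAttraction f e, 0 < β x) ∧
      ∀ x₀ ∈ basinOfAttraction f e, ∃ M ⊆ basinOfAttraction f e, IsCompact M ∧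
        ∀ x : ℝ → E, ∀ b, 0 ≤ b → IsApproxSolOn f β (Icc 0 b) x → x 0 = x₀ → x b ∈ M := by
  classical
  set D := basinOfAttraction f e with hDdef
  obtain ⟨K, hKc, hKD, hKm, hK0, hKx⟩ := exists_compact_exhaustion hD (mem_of_mem_nhds hs.2)
  have hK : ∀ j, ∃ R ⊆ D, IsCompact R ∧ ∃ δ > 0, ∃ T : ℝ, ∀ x₀ ∈ K j, ∃ τ ∈ Icc 1 T,
      ∀ x : ℝ → E, x 0 = x₀ → ∀ b, 0 ≤ b → IsApproxSolOn f (fun _ => δ) (Icc 0 b) x →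
        (b ≤ τ → x b ∈ R) ∧ (b = τ → x b ∈ K 0) := fun j =>
    exists_tube hf hu (hKc j) (hKD j) hD (fun z hz hz0 t ht =>
      basinOfAttraction_forward_invariant hz (hKD j hz0) ht) hK0
  choose R hRD hRc δ hδ T H using hK
  let d : ℕ → ℝ := fun j => (Finset.range (j + 1)).inf' ⟨0, by simp⟩ δ
  have hd : ∀ i j, i ≤ j → d j ≤ δ i := fun i j hij =>
    Finset.inf'_le _ (Finset.mem_range.mpr (by omega))
  have hdpos : ∀ j, 0 < d j := fun j => (Finset.lt_inf'_iff _).mpr fun i _ => hδ i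
  have hdanti : ∀ i j, i ≤ j → d j ≤ d i := fun i j hij =>
    Finset.le_inf' _ _ fun k hk => hd k j (by have := Finset.mem_range.mp hk; omega)
  -- The tolerance depends on the first `K j` containing `x`. As `d` is nonincreasing, outside `K i`
  -- it is at most `δ (i + 1)`, and near a point of `D` it has a positive lower bound.
  let g : E → ℝ := fun x => if h : ∃ j, x ∈ K j then min 1 (d (Nat.find h)) else 0
  have hg0 : ∀ x, 0 ≤ g x := by
    intro x
    by_cases h : ∃ j, x ∈ K j
    · simp only [g, dif_pos h]
      exact le_min zero_le_one (hdpos _).le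
    · simp [g, dif_neg h]
  obtain ⟨β, hβL, hβ0, hβg, hβpos⟩ := exists_lipschitz_minorant (D := D) hg0 (by
    intro x hx
    obtain ⟨j, hj⟩ := hKx x hx
    refine ⟨min 1 (d j), lt_min one_pos (hdpos j), ?_⟩
    filter_upwards [hj] with y hy
    have h : ∃ j, y ∈ K j := ⟨j, hy⟩
    simp only [g, dif_pos h]
    exact min_le_min_left _ (hdanti _ _ (Nat.find_min' h hy)))
  have hg1 : ∀ x, g x ≤ 1 := by
    intro x
    by_cases h : ∃ j, x ∈ K j
    · simp only [g, dif_pos h]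
      exact min_le_left _ _
    · simp [g, dif_neg h]
  have hβ_zero : ∀ x, β x ≤ δ 0 := by
    intro x
    refine (hβg x).trans ?_
    by_cases h : ∃ j, x ∈ K j
    · simp only [g, dif_pos h]
      exact (min_le_right _ _).trans (hd _ _ (Nat.zero_le _))
    · simp only [g, dif_neg h]
      exact (hδ 0).le
  have hβ_succ : ∀ i x, x ∉ K i → β x ≤ δ (i + 1) := by
    intro i x hx
    refine (hβg x).trans ?_
    by_cases h : ∃ j, x ∈ K j
    · simp only [g, dif_pos h]
      refine (min_le_right _ _).trans (hd _ _ ?_)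
      by_contra hlt
      exact hx (hKm (by omega) (Nat.find_spec h))
    · simp only [g, dif_neg h]
      exact (hδ _).le
  refine ⟨β, hβL, hβ0, fun x => (hβg x).trans (hg1 x), hβpos, fun x₀ hx₀ => ?_⟩
  have key : ∀ i, ∀ x : ℝ → E, ∀ b, 0 ≤ b → IsApproxSolOn f β (Icc 0 b) x → x 0 ∈ K i →
      x b ∈ ⋃ j ∈ Finset.range (i + 1), R j := by
    intro i
    induction i with
    | zero =>
      intro x b hb hx hx0
      have := mem_of_recurrent (f := f) (δ := δ 0) (K := K 0) (R := R 0) (fun y hy => by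
        obtain ⟨τ, hτ, h⟩ := H 0 y hy
        exact ⟨τ, hτ.1, h⟩) hb (hx.mono_error fun t _ => hβ_zero _) hx0
      simpa using this
    | succ i ih =>
      intro x b hb hx hx0
      -- Either the curve meets `K i` and induction applies from then on, or it avoids `K i` and its
      -- error is at most `δ (i + 1)`. In the latter case it is still before its time `τ` of arrival
      -- in `K 0 ⊆ K i`, hence in `R (i + 1)`.
      by_cases hhit : ∃ s ∈ Icc 0 b, x s ∈ K i
      · obtain ⟨s, hs, hsK⟩ := hhit
        have := ih (fun t => x (s + t)) (b - s) (by linarith [hs.2])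
          (hx.shift fun t ht => ⟨by linarith [ht.1, hs.1], by linarith [ht.2]⟩) (by simpa using hsK)
        simp only [add_sub_cancel] at this
        exact biUnion_subset_biUnion_left (fun j hj => by
          simp only [Finset.coe_range, mem_Iio] at *; omega) this
      · push Not at hhit
        have hx' : IsApproxSolOn f (fun _ => δ (i + 1)) (Icc 0 b) x :=
          hx.mono_error fun t ht => hβ_succ i _ (hhit t ht)
        obtain ⟨τ, hτ, h⟩ := H (i + 1) _ hx0
        have hτ0 : 0 ≤ τ := zero_le_one.trans hτ.1
        have hbτ : b ≤ τ := by
          by_contra hlt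
          have hτb : τ ≤ b := (not_le.mp hlt).le
          exact hhit τ ⟨hτ0, hτb⟩ (hKm (Nat.zero_le i)
            ((h x rfl τ hτ0 (hx'.mono (Icc_subset_Icc_right hτb))).2 rfl))
        exact mem_biUnion (by simp) ((h x rfl b hb hx').1 hbτ)
  obtain ⟨j, hj⟩ := hKx x₀ hx₀
  refine ⟨⋃ i ∈ Finset.range (j + 1), R i, iUnion₂_subset fun i _ => hRD i,
    (Finset.range (j + 1)).isCompact_biUnion fun i _ => hRc i, ?_⟩
  rintro x b hb hx rfl
  exact key j x b hb hx (mem_of_mem_nhds hj)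

end Robustness

/-! ### Global existence from a priori bounds -/

section APriori

variable {E : Type*} [NormedAddCommGroup E] [NormedSpace ℝ E]

/-- A priori bounded solutions of a continuous vector field exist for all nonnegative times and
solutions on bounded intervals extend. -/
theorem exists_global_of_bounded [FiniteDimensional ℝ E] {F : E → E} (hF : Continuous F) {z₀ : E}
    {ρ : ℝ} (h0 : ‖z₀‖ ≤ ρ) (hρ : ∀ T : ℝ, 0 < T → ∀ z : ℝ → E, IsSolutionOn F (Ico 0 T) z →
      z 0 = z₀ → ∀ t ∈ Ico 0 T, ‖z t‖ ≤ ρ) :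
    (∃ z : ℝ → E, IsSolutionOn F (Ici 0) z ∧ z 0 = z₀) ∧
    ∀ T : ℝ, 0 < T → ∀ z : ℝ → E, IsSolutionOn F (Ico 0 T) z → z 0 = z₀ →
      ∃ w : ℝ → E, IsSolutionOn F (Ici 0) w ∧ EqOn w z (Ico 0 T) := by
  have : ProperSpace E := FiniteDimensional.proper ℝ E
  -- The cutoff makes the field bounded and uniformly continuous. The margin between `ρ` and `ρ + 1`
  -- keeps its solutions in the region where nothing changed: before first reaching norm `ρ + 1`
  -- they solve the original equation, so their norm is at most `ρ`.
  let χ : E → ℝ := fun z => max 0 (min 1 (ρ + 2 - ‖z‖))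
  have hχc : Continuous χ := by fun_prop
  have hχ1 : ∀ z, ‖z‖ ≤ ρ + 1 → χ z = 1 := by
    intro z hz
    simp only [χ]
    rw [min_eq_left (by linarith), max_eq_right zero_le_one]
  let F' : E → E := fun z => χ z • F z
  have hF'c : Continuous F' := hχc.smul hF
  have hsupp : HasCompactSupport F' := by
    refine HasCompactSupport.intro (isCompact_closedBall (0 : E) (ρ + 2)) fun z hz => ?_
    have hz' : ρ + 2 < ‖z‖ := by simpa using hz
    simp only [F', χ]
    rw [max_eq_left ((min_le_right _ _).trans (by linarith)), zero_smul]
  have hF'u : UniformContinuous F' := hsupp.uniformContinuous_of_continuous hF'c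
  obtain ⟨B, hB⟩ := hsupp.exists_bound_of_continuous hF'c
  have heq : ∀ z, ‖z‖ ≤ ρ + 1 → F' z = F z := fun z hz => by simp [F', hχ1 z hz]
  have hglob : ∀ w : ℝ → E, IsSolutionOn F' (Ici 0) w → w 0 = z₀ → IsSolutionOn F (Ici 0) w := by
    intro w hw hw0
    have hbound : ∀ t, 0 ≤ t → ‖w t‖ < ρ + 1 := by
      by_contra! hcon
      obtain ⟨b, hb0, hb⟩ := hcon
      have hc : ContinuousOn (fun t => ‖w t‖) (Ici 0) := hw.continuousOn.norm
      have hcl := (hc.mono (Icc_subset_Ici_self : Icc 0 b ⊆ Ici 0)).preimage_isClosed_of_isClosed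
        isClosed_Icc (isClosed_Ici (a := ρ + 1))
      obtain ⟨s, ⟨hs, hsρ⟩, hmin⟩ := (isCompact_Icc.of_isClosed_subset hcl
        inter_subset_left).exists_isLeast ⟨b, ⟨hb0, le_rfl⟩, hb⟩
      have hsρ' : ρ + 1 ≤ ‖w s‖ := hsρ
      have hs0 : 0 < s := by
        rcases hs.1.eq_or_lt with h | h
        · rw [← h, hw0] at hsρ'; linarith
        · exact h
      have hlt : ∀ t ∈ Ico 0 s, ‖w t‖ < ρ + 1 := by
        intro t ht
        by_contra hge
        exact absurd (hmin ⟨⟨ht.1, ht.2.le.trans hs.2⟩, not_lt.mp hge⟩) (not_le.mpr ht.2)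
      have hsol : IsSolutionOn F (Ico 0 s) w := by
        intro t ht
        rw [← heq _ (hlt t ht).le]
        exact hw.mono Ico_subset_Ici_self t ht
      have hle := hρ s hs0 w hsol hw0
      have hlim : Tendsto (fun t => ‖w t‖) (𝓝[<] s) (𝓝 ‖w s‖) :=
        (hc.continuousAt (Ici_mem_nhds hs0)).tendsto.mono_left nhdsWithin_le_nhds
      have := le_of_tendsto hlim (b := ρ) (by
        filter_upwards [self_mem_nhdsWithin, mem_nhdsWithin_of_mem_nhds (Ioi_mem_nhds hs0)]
          with t ht ht0
        exact hle t ⟨le_of_lt ht0, ht⟩)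
      linarith
    intro t ht
    rw [← heq _ (hbound t ht).le]
    exact hw t ht
  refine ⟨?_, fun T hT z hz hz0 => ?_⟩
  · obtain ⟨w, hw, hw0⟩ := exists_isSolutionOn_Ici hF'u hB z₀
    exact ⟨w, hglob w hw hw0, hw0⟩
  · have hz' : IsSolutionOn F' (Ico 0 T) z := by
      intro t ht
      rw [heq _ ((hρ T hT z hz hz0 t ht).trans (by linarith))]
      exact hz t ht
    obtain ⟨w, hw, hwz⟩ := exists_extension_Ici hF'u hB hT hz'
    exact ⟨w, hglob w hw (by rw [hwz ⟨le_rfl, hT⟩, hz0]), hwz⟩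

end APriori

/-! ### Quadratic forms and the sup norm -/

section QuadraticForms

theorem exists_norm_mulVec_le {k l : ℕ} (M : Matrix (Fin k) (Fin l) ℝ) :
    ∃ κ : ℝ, 0 ≤ κ ∧ ∀ y, ‖M *ᵥ y‖ ≤ κ * ‖y‖ :=
  ⟨‖M.mulVecLin.toContinuousLinearMap‖, norm_nonneg _,
    fun y => M.mulVecLin.toContinuousLinearMap.le_opNorm y⟩

theorem HasDerivWithinAt.matrix_mulVec {k l : ℕ} (M : Matrix (Fin k) (Fin l) ℝ)
    {x : ℝ → Fin l → ℝ} {v : Fin l → ℝ} {I : Set ℝ} {t : ℝ} (h : HasDerivWithinAt x v I t) :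
    HasDerivWithinAt (fun s => M *ᵥ x s) (M *ᵥ v) I t :=
  M.mulVecLin.toContinuousLinearMap.hasFDerivAt.comp_hasDerivWithinAt t h

theorem HasDerivWithinAt.quadraticForm {k : ℕ} {P : Matrix (Fin k) (Fin k) ℝ} (hP : Pᵀ = P)
    {x : ℝ → Fin k → ℝ} {v : Fin k → ℝ} {I : Set ℝ} {t : ℝ} (h : HasDerivWithinAt x v I t) :
    HasDerivWithinAt (fun s => x s ⬝ᵥ (P *ᵥ x s)) (2 * (x t ⬝ᵥ (P *ᵥ v))) I t := by
  have h1 := hasDerivWithinAt_pi.mp h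
  have h2 := hasDerivWithinAt_pi.mp (h.matrix_mulVec P)
  have h3 := HasDerivWithinAt.fun_sum (u := Finset.univ) fun i _ => (h1 i).fun_mul (h2 i)
  refine h3.congr_deriv ?_
  rw [Finset.sum_add_distrib]
  change v ⬝ᵥ (P *ᵥ x t) + x t ⬝ᵥ (P *ᵥ v) = _
  rw [Matrix.dotProduct_mulVec v, ← Matrix.mulVec_transpose, hP, dotProduct_comm]
  ring

theorem continuous_quadraticForm {k : ℕ} (P : Matrix (Fin k) (Fin k) ℝ) :
    Continuous fun x : Fin k → ℝ => x ⬝ᵥ (P *ᵥ x) :=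
  continuous_id.dotProduct (continuous_const.matrix_mulVec continuous_id)

theorem sq_norm_le_dotProduct_self {k : ℕ} (y : Fin k → ℝ) : ‖y‖ ^ 2 ≤ y ⬝ᵥ y := by
  have h0 : 0 ≤ y ⬝ᵥ y := Finset.sum_nonneg fun i _ => mul_self_nonneg _
  have : ‖y‖ ≤ √(y ⬝ᵥ y) := by
    refine (pi_norm_le_iff_of_nonneg (Real.sqrt_nonneg _)).mpr fun i => ?_
    refine Real.abs_le_sqrt ?_
    rw [sq]
    exact Finset.single_le_sum (f := fun i => y i * y i) (fun j _ => mul_self_nonneg _)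
      (Finset.mem_univ i)
  calc ‖y‖ ^ 2 ≤ √(y ⬝ᵥ y) ^ 2 := by gcongr
    _ = _ := Real.sq_sqrt h0

/-- The constant is the minimum of the form on the unit sphere, extended by homogeneity; the sphere
is empty when `k = 0`. -/
theorem Matrix.PosDef.exists_sq_norm_le {k : ℕ} {P : Matrix (Fin k) (Fin k) ℝ} (hP : P.PosDef) :
    ∃ c > 0, ∀ x : Fin k → ℝ, c * ‖x‖ ^ 2 ≤ x ⬝ᵥ (P *ᵥ x) := by
  have hpos : ∀ x : Fin k → ℝ, x ≠ 0 → 0 < x ⬝ᵥ (P *ᵥ x) := fun x hx => by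
    simpa using hP.dotProduct_mulVec_pos hx
  rcases (Metric.sphere (0 : Fin k → ℝ) 1).eq_empty_or_nonempty with he | hne
  · refine ⟨1, one_pos, fun x => ?_⟩
    have hx : x = 0 := by
      by_contra hx
      have : ‖x‖⁻¹ • x ∈ Metric.sphere (0 : Fin k → ℝ) 1 := by
        simp [norm_smul, norm_ne_zero_iff.mpr hx]
      simp [he] at this
    simp [hx]
  · obtain ⟨u, hu, hmin⟩ := (isCompact_sphere (0 : Fin k → ℝ) 1).exists_isMinOn hne
      (continuous_quadraticForm P).continuousOn
    have hu0 : u ≠ 0 := by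
      rintro rfl
      simp at hu
    refine ⟨_, hpos u hu0, fun x => ?_⟩
    by_cases hx : x = 0
    · simp [hx]
    · have hn : ‖x‖ ≠ 0 := norm_ne_zero_iff.mpr hx
      have h1 : ‖x‖⁻¹ • x ∈ Metric.sphere (0 : Fin k → ℝ) 1 := by simp [norm_smul, hn]
      have h2 := isMinOn_iff.mp hmin _ h1
      simp only [Matrix.mulVec_smul, smul_dotProduct, dotProduct_smul, smul_eq_mul] at h2
      calc (u ⬝ᵥ (P *ᵥ u)) * ‖x‖ ^ 2
          ≤ (‖x‖⁻¹ * (‖x‖⁻¹ * (x ⬝ᵥ (P *ᵥ x)))) * ‖x‖ ^ 2 := by gcongr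
        _ = x ⬝ᵥ (P *ᵥ x) := by field_simp

end QuadraticForms

/-! ### Lyapunov decrease and convergence of the observer -/

section Observer

variable {n m p : ℕ} {A : (Fin m → ℝ) → Matrix (Fin n) (Fin n) ℝ} {B : (Fin m → ℝ) → (Fin n → ℝ)}
  {C : Matrix (Fin p) (Fin n) ℝ} {lam : (Fin n → ℝ) → (Fin m → ℝ)}
  {P : Matrix (Fin n) (Fin n) ℝ} {α : (Fin n → ℝ) → (Fin p → ℝ) → ℝ}

theorem continuous_feedbackField (hA : Continuous A) (hB : Continuous B) (hlam : Continuous lam) :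
    Continuous (feedbackField A B lam) :=
  ((hA.comp hlam).matrix_mulVec continuous_id).add (hB.comp hlam)

theorem continuous_observerField (hA : Continuous A) (hB : Continuous B) (hlam : Continuous lam)
    (hα : Continuous (Function.uncurry α)) : Continuous (observerField A B C lam P α) := by
  have h1 : Continuous fun z : (Fin n → ℝ) × (Fin n → ℝ) => lam z.1 := hlam.comp continuous_fst
  have h2 : Continuous fun z : (Fin n → ℝ) × (Fin n → ℝ) => α z.1 (C *ᵥ z.2) :=
    hα.comp (continuous_fst.prodMk (continuous_const.matrix_mulVec continuous_snd))
  exact ((((hA.comp h1).matrix_mulVec continuous_fst).add (hB.comp h1)).sub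
    (h2.smul (continuous_const.matrix_mulVec continuous_snd))).prodMk
    (((hA.comp h1).sub (h2.smul continuous_const)).matrix_mulVec continuous_snd)

theorem IsSolutionOn.hasDerivWithinAt_fst {E F : Type*} [NormedAddCommGroup E] [NormedSpace ℝ E]
    [NormedAddCommGroup F] [NormedSpace ℝ F] {G : E × F → E × F} {I : Set ℝ} {z : ℝ → E × F}
    (hz : IsSolutionOn G I z) {t : ℝ} (ht : t ∈ I) :
    HasDerivWithinAt (fun s => (z s).1) (G (z t)).1 I t :=
  (ContinuousLinearMap.fst ℝ E F).hasFDerivAt.comp_hasDerivWithinAt t (hz t ht)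

theorem IsSolutionOn.hasDerivWithinAt_snd {E F : Type*} [NormedAddCommGroup E] [NormedSpace ℝ E]
    [NormedAddCommGroup F] [NormedSpace ℝ F] {G : E × F → E × F} {I : Set ℝ} {z : ℝ → E × F}
    (hz : IsSolutionOn G I z) {t : ℝ} (ht : t ∈ I) :
    HasDerivWithinAt (fun s => (z s).2) (G (z t)).2 I t :=
  (ContinuousLinearMap.snd ℝ E F).hasFDerivAt.comp_hasDerivWithinAt t (hz t ht)

/-- The observer state is an approximate solution of the state feedback closed loop. -/
theorem observer_isApproxSolOn {g : (Fin n → ℝ) → ℝ} {I : Set ℝ}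
    {z : ℝ → (Fin n → ℝ) × (Fin n → ℝ)} (hz : IsSolutionOn (observerField A B C lam P α) I z)
    (hg : ∀ t ∈ I, ‖α (z t).1 (C *ᵥ (z t).2) • ((P⁻¹ * Cᵀ * C) *ᵥ (z t).2)‖ ≤ g (z t).1) :
    IsApproxSolOn (feedbackField A B lam) g I fun t => (z t).1 := by
  intro t ht
  refine ⟨_, hz.hasDerivWithinAt_fst ht, ?_⟩
  simpa [observerField, feedbackField] using hg t ht

/-- Uniqueness of solutions of the observer yields uniqueness for the state feedback loop. -/
theorem hasForwardUniqueness_feedbackField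
    (h : HasUniqueGlobalSolutions (observerField A B C lam P α)) :
    HasForwardUniqueness (feedbackField A B lam) := by
  have key : ∀ x : ℝ → (Fin n → ℝ), IsSolutionOn (feedbackField A B lam) (Ici 0) x →
      IsSolutionOn (observerField A B C lam P α) (Ici 0) fun t => (x t, 0) := by
    intro x hx t ht
    refine ((hx t ht).prodMk (hasDerivWithinAt_const t _ (0 : Fin n → ℝ))).congr_deriv ?_
    simp [observerField, feedbackField]
  intro x y hx hy hxy t ht
  obtain ⟨z, -, hz⟩ := h (x 0, 0)
  have h1 := hz _ (key x hx) rfl ht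
  have h2 := hz _ (key y hy) (by simp [hxy]) ht
  exact congrArg Prod.fst (h1.trans h2.symm)

/-- The quadratic form `P` of the error is a Lyapunov function. -/
theorem observer_lyapunov (hP : P.PosDef) {a b μ : ℝ} (hab : a ≤ b)
    {z : ℝ → (Fin n → ℝ) × (Fin n → ℝ)}
    (hz : IsSolutionOn (observerField A B C lam P α) (Icc a b) z)
    (hdiss : ∀ t ∈ Icc a b, (z t).2 ⬝ᵥ ((P * A (lam (z t).1)) *ᵥ (z t).2) ≤ 0)
    (hμ : ∀ t ∈ Icc a b,
      μ ≤ α (z t).1 (C *ᵥ (z t).2) * ((C *ᵥ (z t).2) ⬝ᵥ (C *ᵥ (z t).2))) :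
    (z b).2 ⬝ᵥ (P *ᵥ (z b).2) ≤ (z a).2 ⬝ᵥ (P *ᵥ (z a).2) - 2 * μ * (b - a) := by
  have hPt : Pᵀ = P := by simpa [Matrix.conjTranspose_eq_transpose_of_trivial] using hP.isHermitian.eq
  have hdet : IsUnit P.det := (Matrix.isUnit_iff_isUnit_det P).mp hP.isUnit
  have hd : ∀ t ∈ Icc a b, HasDerivWithinAt
      (fun s => (z s).2 ⬝ᵥ (P *ᵥ (z s).2) + 2 * μ * s)
      (2 * ((z t).2 ⬝ᵥ (P *ᵥ (observerField A B C lam P α (z t)).2)) + 2 * μ) (Icc a b) t := by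
    intro t ht
    have h2 := ((hasDerivAt_id t).const_mul (2 * μ)).hasDerivWithinAt (s := Icc a b)
    rw [mul_one] at h2
    exact ((hz.hasDerivWithinAt_snd ht).quadraticForm hPt).fun_add h2
  have hneg : ∀ t ∈ Icc a b,
      2 * ((z t).2 ⬝ᵥ (P *ᵥ (observerField A B C lam P α (z t)).2)) + 2 * μ ≤ 0 := by
    intro t ht
    have h1 := hdiss t ht
    have h2 := hμ t ht
    have h3 : (z t).2 ⬝ᵥ (P *ᵥ (observerField A B C lam P α (z t)).2) =
        (z t).2 ⬝ᵥ ((P * A (lam (z t).1)) *ᵥ (z t).2) -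
        α (z t).1 (C *ᵥ (z t).2) * ((C *ᵥ (z t).2) ⬝ᵥ (C *ᵥ (z t).2)) := by
      -- The factor `P⁻¹` in the correction cancels `P`, so the correction contributes exactly `-α
      -- |Cε|²`.
      have h4 : P * (P⁻¹ * Cᵀ * C) = Cᵀ * C := by
        rw [Matrix.mul_assoc P⁻¹, Matrix.mul_nonsing_inv_cancel_left _ _ hdet]
      simp only [observerField]
      rw [Matrix.mulVec_mulVec, Matrix.mul_sub, Matrix.mul_smul, h4, Matrix.sub_mulVec,
        Matrix.smul_mulVec, dotProduct_sub, dotProduct_smul, smul_eq_mul, ← Matrix.mulVec_mulVec _ Cᵀ,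
        Matrix.dotProduct_mulVec (z t).2 Cᵀ, Matrix.vecMul_transpose]
    linarith
  have hanti := antitoneOn_of_hasDerivWithinAt_nonpos (convex_Icc a b)
    (fun t ht => (hd t ht).continuousWithinAt)
    (fun t ht => (hd t (interior_subset ht)).mono interior_subset)
    (fun t ht => hneg t (interior_subset ht))
  have := hanti ⟨le_rfl, hab⟩ ⟨hab, le_rfl⟩ hab
  simp only at this
  linarith

theorem observer_lyapunov_le (hP : P.PosDef) (hα : ∀ x y, 0 ≤ α x y) {a b : ℝ} (hab : a ≤ b)
    {z : ℝ → (Fin n → ℝ) × (Fin n → ℝ)}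
    (hz : IsSolutionOn (observerField A B C lam P α) (Icc a b) z)
    (hdiss : ∀ t ∈ Icc a b, (z t).2 ⬝ᵥ ((P * A (lam (z t).1)) *ᵥ (z t).2) ≤ 0) :
    (z b).2 ⬝ᵥ (P *ᵥ (z b).2) ≤ (z a).2 ⬝ᵥ (P *ᵥ (z a).2) := by
  have := observer_lyapunov hP (μ := 0) hab hz hdiss fun t _ =>
    mul_nonneg (hα _ _) (Finset.sum_nonneg fun i _ => mul_self_nonneg _)
  simpa using this

/-- The output of a bounded error trajectory converges to zero. -/
theorem observer_output_tendsto (hA : Continuous A) (hB : Continuous B) (hlam : Continuous lam)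
    (hP : P.PosDef) (hαc : Continuous (Function.uncurry α)) {M : Set (Fin n → ℝ)} (hM : IsCompact M)
    (hdiss : ∀ x : Fin n → ℝ, ∀ xhat ∈ M, x ⬝ᵥ ((P * A (lam xhat)) *ᵥ x) ≤ 0)
    (hαpos : ∀ x ∈ M, ∀ y, 0 < α x y)
    {z : ℝ → (Fin n → ℝ) × (Fin n → ℝ)}
    (hz : IsSolutionOn (observerField A B C lam P α) (Ici 0) z) {r ℓ : ℝ}
    (hzM : ∀ t, 0 ≤ t → (z t).1 ∈ M) (hzr : ∀ t, 0 ≤ t → ‖(z t).2‖ ≤ r)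
    (hℓ : Tendsto (fun t => (z t).2 ⬝ᵥ (P *ᵥ (z t).2)) atTop (𝓝 ℓ)) :
    Tendsto (fun t => C *ᵥ (z t).2) atTop (𝓝 0) := by
  obtain ⟨κ, hκ0, hκ⟩ := exists_norm_mulVec_le C
  have hN : IsCompact (M ×ˢ Metric.closedBall (0 : Fin n → ℝ) r) :=
    hM.prod (isCompact_closedBall _ _)
  have hzN : ∀ t, 0 ≤ t → z t ∈ M ×ˢ Metric.closedBall (0 : Fin n → ℝ) r := fun t ht =>
    ⟨hzM t ht, by simpa using hzr t ht⟩
  obtain ⟨L, hL⟩ := (hN.image (continuous_observerField (C := C) (P := P) hA hB hlam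
    hαc)).isBounded.exists_norm_le
  have hzL : ∀ t, 0 ≤ t → ‖observerField A B C lam P α (z t)‖ ≤ L := fun t ht =>
    hL _ ⟨_, hzN t ht, rfl⟩
  have hL0 : 0 ≤ L := (norm_nonneg _).trans (hzL 0 le_rfl)
  obtain ⟨u, hu, hmin⟩ := hN.exists_isMinOn ⟨_, hzN 0 le_rfl⟩
    (f := fun w : (Fin n → ℝ) × (Fin n → ℝ) => α w.1 (C *ᵥ w.2)) (hαc.comp
      (continuous_fst.prodMk (continuous_const.matrix_mulVec continuous_snd))).continuousOn
  set a := α u.1 (C *ᵥ u.2) with ha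
  have ha0 : 0 < a := hαpos _ hu.1 _
  have hza : ∀ t, 0 ≤ t → a ≤ α (z t).1 (C *ᵥ (z t).2) := fun t ht =>
    isMinOn_iff.mp hmin _ (hzN t ht)
  rw [Metric.tendsto_nhds]
  intro c hc
  -- During a time `h` the output changes by at most `c / 2`. An output of size `c` at time `t` thus
  -- costs `V` at least `2 * (a * (c / 2) ^ 2) * h`, impossible for large `t` since `V` converges.
  set h : ℝ := c / 2 / (κ * L + 1) with hh
  have hh0 : 0 < h := by positivity
  have hdiff : Tendsto (fun t => (z t).2 ⬝ᵥ (P *ᵥ (z t).2) -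
      (z (t + h)).2 ⬝ᵥ (P *ᵥ (z (t + h)).2)) atTop (𝓝 (ℓ - ℓ)) :=
    hℓ.sub (hℓ.comp (tendsto_atTop_add_const_right atTop h tendsto_id))
  rw [sub_self] at hdiff
  have hpos : 0 < 2 * (a * (c / 2) ^ 2) * h := by positivity
  filter_upwards [hdiff.eventually (Iio_mem_nhds hpos), eventually_ge_atTop 0] with t ht ht0
  by_contra hge
  rw [dist_zero_right, not_lt] at hge
  have hsub : Icc t (t + h) ⊆ Ici 0 := fun s hs => ht0.trans hs.1
  have hy : ∀ s ∈ Icc t (t + h), c / 2 ≤ ‖C *ᵥ (z s).2‖ := by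
    intro s hs
    have h1 := (hz.isApproxSolOn.mono hsub).norm_sub_le (convex_Icc _ _)
      (fun r hr => hzL r (hsub hr)) hs (t := t) ⟨le_rfl, by linarith⟩
    have h2 : ‖C *ᵥ (z t).2‖ ≤ ‖C *ᵥ (z s).2‖ + κ * (L * h) := by
      calc ‖C *ᵥ (z t).2‖ = ‖C *ᵥ (z s).2 + C *ᵥ ((z t).2 - (z s).2)‖ := by
            rw [Matrix.mulVec_sub]; congr 1; abel
        _ ≤ ‖C *ᵥ (z s).2‖ + κ * ‖(z t).2 - (z s).2‖ :=
            (norm_add_le _ _).trans (add_le_add le_rfl (hκ _))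
        _ ≤ _ := by
            gcongr
            refine (norm_snd_le (z t - z s)).trans (h1.trans ?_)
            rw [add_zero]
            gcongr
            rw [abs_sub_comm, abs_of_nonneg (by linarith [hs.1])]
            linarith [hs.2]
    have h3 : κ * (L * h) ≤ c / 2 := by
      have : (κ * L + 1) * h = c / 2 := by rw [hh]; field_simp
      nlinarith
    linarith
  have hdec := observer_lyapunov hP (μ := a * (c / 2) ^ 2) (by linarith : t ≤ t + h)
    (hz.mono hsub) (fun s hs => hdiss _ _ (hzM s (hsub hs))) (fun s hs => by
      refine mul_le_mul (hza s (hsub hs)) ?_ (by positivity) (ha0.le.trans (hza s (hsub hs)))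
      refine le_trans ?_ (sq_norm_le_dotProduct_self _)
      have := hy s hs
      gcongr)
  have ht' : (z t).2 ⬝ᵥ (P *ᵥ (z t).2) - (z (t + h)).2 ⬝ᵥ (P *ᵥ (z (t + h)).2) <
    2 * (a * (c / 2) ^ 2) * h := ht
  rw [add_sub_cancel_left] at hdec
  linarith

/-- Trajectories of the observer that remain in a compact subset of the basin of attraction of the
state feedback closed loop converge to the origin. -/
theorem observer_tendsto (hA : Continuous A) (hB : Continuous B) (hlam : Continuous lam)
    (hlam0 : lam 0 = 0) (hu : HasForwardUniqueness (feedbackField A B lam))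
    (hs : IsAsymptoticallyStable (feedbackField A B lam) 0) (hP : P.PosDef)
    (hdet : IsDetectablePair C (A 0)) (hαc : Continuous (Function.uncurry α))
    (hα0 : ∀ x y, 0 ≤ α x y) {κ : ℝ}
    (hκ : ∀ x ε, ‖α x (C *ᵥ ε) • ((P⁻¹ * Cᵀ * C) *ᵥ ε)‖ ≤ κ * ‖C *ᵥ ε‖)
    {M : Set (Fin n → ℝ)} (hM : IsCompact M) (hMD : M ⊆ basinOfAttraction (feedbackField A B lam) 0)
    (hdiss : ∀ x : Fin n → ℝ, ∀ xhat ∈ M, x ⬝ᵥ ((P * A (lam xhat)) *ᵥ x) ≤ 0)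
    (hαpos : ∀ x ∈ M, ∀ y, 0 < α x y)
    {z : ℝ → (Fin n → ℝ) × (Fin n → ℝ)}
    (hz : IsSolutionOn (observerField A B C lam P α) (Ici 0) z) {r : ℝ}
    (hzM : ∀ t, 0 ≤ t → (z t).1 ∈ M) (hzr : ∀ t, 0 ≤ t → ‖(z t).2‖ ≤ r) :
    Tendsto z atTop (𝓝 (0, 0)) := by
  have hFc := continuous_observerField (C := C) (P := P) hA hB hlam hαc
  have hV0 : ∀ x : Fin n → ℝ, 0 ≤ x ⬝ᵥ (P *ᵥ x) := fun x => by
    simpa using hP.posSemidef.dotProduct_mulVec_nonneg x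
  have hanti : Antitone fun t : ℝ => (z (max t 0)).2 ⬝ᵥ (P *ᵥ (z (max t 0)).2) := by
    intro s t hst
    have hsub : Icc (max s 0) (max t 0) ⊆ Ici 0 := fun r hr => (le_max_right s 0).trans hr.1
    exact observer_lyapunov_le hP hα0 (max_le_max_right 0 hst) (hz.mono hsub)
      (fun r hr => hdiss _ _ (hzM r (hsub hr)))
  obtain ⟨ℓ, hℓ⟩ : ∃ ℓ, Tendsto (fun t => (z t).2 ⬝ᵥ (P *ᵥ (z t).2)) atTop (𝓝 ℓ) := by
    refine ⟨_, (tendsto_atTop_ciInf hanti ⟨0, ?_⟩).congr' ?_⟩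
    · rintro _ ⟨t, rfl⟩
      exact hV0 _
    · filter_upwards [eventually_ge_atTop 0] with t ht
      rw [max_eq_left ht]
  have hy := observer_output_tendsto hA hB hlam hP hαc hM hdiss hαpos hz hzM hzr hℓ
  have hx : Tendsto (fun t => (z t).1) atTop (𝓝 0) := by
    intro U hU
    obtain ⟨δ, hδ, T, hT, H⟩ := exists_attraction_of_approx
      (continuous_feedbackField hA hB hlam) hu hs hM hMD hU
    have hy' : Tendsto (fun t => κ * ‖C *ᵥ (z t).2‖) atTop (𝓝 0) := by
      simpa using hy.norm.const_mul κ
    obtain ⟨t₀, ht₀⟩ := eventually_atTop.mp (hy'.eventually (Iio_mem_nhds hδ))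
    change ∀ᶠ t in atTop, (z t).1 ∈ U
    filter_upwards [eventually_ge_atTop (max t₀ 0 + T)] with t ht
    have hmap : MapsTo (fun s => max t₀ 0 + s) (Icc 0 (t - max t₀ 0)) (Ici (max t₀ 0)) := by
      intro s hs
      simp only [mem_Ici]
      linarith [hs.1]
    have happ : IsApproxSolOn (feedbackField A B lam) (fun _ => δ) (Ici (max t₀ 0))
        fun s => (z s).1 :=
      observer_isApproxSolOn (hz.mono (Ici_subset_Ici.mpr (le_max_right _ _))) fun s hs =>
        (hκ _ _).trans (ht₀ s ((le_max_left _ _).trans hs)).le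
    have := H (fun s => (z (max t₀ 0 + s)).1) (t - max t₀ 0) (by linarith) (happ.shift hmap)
      (by simpa using hzM _ (le_max_right t₀ 0))
    simpa using this
  have hN : IsCompact (M ×ˢ Metric.closedBall (0 : Fin n → ℝ) r) :=
    hM.prod (isCompact_closedBall _ _)
  have hzN : ∀ t, 0 ≤ t → z t ∈ M ×ˢ Metric.closedBall (0 : Fin n → ℝ) r := fun t ht =>
    ⟨hzM t ht, by simpa using hzr t ht⟩
  obtain ⟨L, hL⟩ := (hN.image hFc).isBounded.exists_norm_le
  obtain ⟨R, hR⟩ := hN.isBounded.exists_norm_le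
  -- LaSalle's argument: `w` is a limit of translates of `z`, so it inherits the limits of `x̂`,
  -- `Cε` and `V` as constant values.
  obtain ⟨w, hw, hwsol⟩ := exists_isSolutionOn_of_approx (hyperfilter ℕ) hFc
    (x := fun k t => z (k + t)) (δ := fun _ => 0) (J := Ici 0) (R := R) (B := L)
    (fun t ht => Ici_zero_forward ht) tendsto_const_nhds
    (fun k => hR _ (hzN _ (by positivity)))
    (fun t _ => Eventually.of_forall fun k =>
      ⟨hz.isApproxSolOn.shift fun s hs => add_nonneg (Nat.cast_nonneg k) hs.1,
        fun s hs => hL _ ⟨_, hzN _ (add_nonneg (Nat.cast_nonneg k) hs.1), rfl⟩⟩)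
  have hshift : ∀ t : ℝ, Tendsto (fun k : ℕ => (k : ℝ) + t) (hyperfilter ℕ) atTop := fun t =>
    (tendsto_atTop_add_const_right _ t tendsto_natCast_atTop_atTop).comp tendsto_hyperfilter_atTop
  have hw1 : ∀ t ∈ Ici (0 : ℝ), (w t).1 = 0 := fun t ht =>
    tendsto_nhds_unique ((continuous_fst.tendsto _).comp (hw t ht)) (hx.comp (hshift t))
  have hwC : ∀ t ∈ Ici (0 : ℝ), C *ᵥ (w t).2 = 0 := fun t ht =>
    tendsto_nhds_unique (((continuous_const.matrix_mulVec continuous_snd).tendsto _).comp (hw t ht))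
      (hy.comp (hshift t))
  have hwV : ∀ t ∈ Ici (0 : ℝ), (w t).2 ⬝ᵥ (P *ᵥ (w t).2) = ℓ := fun t ht =>
    tendsto_nhds_unique ((((continuous_quadraticForm P).comp continuous_snd).tendsto _).comp
      (hw t ht)) (hℓ.comp (hshift t))
  have hω : Tendsto (fun t => (w t).2) atTop (𝓝 0) := by
    refine hdet _ (fun t ht => ?_) hwC
    refine (hwsol.hasDerivWithinAt_snd ht).congr_deriv ?_
    simp only [observerField]
    rw [hw1 t ht, hlam0, Matrix.sub_mulVec, Matrix.smul_mulVec, ← Matrix.mulVec_mulVec, hwC t ht,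
      Matrix.mulVec_zero, smul_zero, sub_zero]
  have hℓ0 : ℓ = 0 := by
    have h1 : Tendsto (fun t => (w t).2 ⬝ᵥ (P *ᵥ (w t).2)) atTop (𝓝 ((0 : Fin n → ℝ) ⬝ᵥ (P *ᵥ 0))) :=
      ((continuous_quadraticForm P).tendsto 0).comp hω
    rw [zero_dotProduct] at h1
    refine tendsto_nhds_unique (tendsto_const_nhds.congr' ?_) h1
    filter_upwards [eventually_ge_atTop 0] with t ht
    exact (hwV t ht).symm
  obtain ⟨c, hc, hcV⟩ := hP.exists_sq_norm_le
  have hε : Tendsto (fun t => (z t).2) atTop (𝓝 0) := by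
    rw [tendsto_zero_iff_norm_tendsto_zero]
    have h1 : Tendsto (fun t => ‖(z t).2‖ ^ 2) atTop (𝓝 0) := by
      have h2 : Tendsto (fun t => (z t).2 ⬝ᵥ (P *ᵥ (z t).2) / c) atTop (𝓝 0) := by
        simpa [hℓ0] using hℓ.div_const c
      refine squeeze_zero (fun _ => by positivity) (fun t => ?_) h2
      rw [le_div_iff₀ hc, mul_comm]
      exact hcV _
    simpa using h1.sqrt
  exact hx.prodMk_nhds hε

end Observer

/-! ### Regularity of the gain -/

section Gain

/-- Normalization of a bounded Lipschitz gain by the size of the output. -/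
theorem locallyLipschitz_normalized_gain {X Y : Type*} [PseudoMetricSpace X]
    [SeminormedAddCommGroup Y] {β : X → ℝ} (hβ : LipschitzWith 1 β) (hβ0 : ∀ x, 0 ≤ β x)
    (hβ1 : ∀ x, β x ≤ 1) {κ : ℝ} (hκ : 0 ≤ κ) :
    LocallyLipschitz (Function.uncurry fun (x : X) (y : Y) => β x / (1 + κ * ‖y‖)) := by
  have hL : LipschitzWith (1 + κ.toNNReal)
      (Function.uncurry fun (x : X) (y : Y) => β x / (1 + κ * ‖y‖)) := by
    refine LipschitzWith.of_dist_le_mul ?_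
    rintro ⟨x, y⟩ ⟨x', y'⟩
    have h1 : |β x - β x'| ≤ dist (x, y) (x', y') := by
      have := hβ.dist_le_mul x x'
      rw [NNReal.coe_one, one_mul, Real.dist_eq] at this
      exact this.trans (by simp [Prod.dist_eq])
    have h2 : |‖y'‖ - ‖y‖| ≤ dist (x, y) (x', y') := by
      rw [abs_sub_comm]
      exact (abs_norm_sub_norm_le y y').trans (by simp [Prod.dist_eq, dist_eq_norm])
    have hp : 1 ≤ 1 + κ * ‖y‖ := by
      have : 0 ≤ κ * ‖y‖ := by positivity
      linarith
    have hp' : 1 ≤ 1 + κ * ‖y'‖ := by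
      have : 0 ≤ κ * ‖y'‖ := by positivity
      linarith
    -- The variation in `x` costs the constant `1` and that in `y` the constant `κ`, because the
    -- denominators are at least `1` and `β ≤ 1`.
    have hsplit : β x / (1 + κ * ‖y‖) - β x' / (1 + κ * ‖y'‖) =
        (β x - β x') / (1 + κ * ‖y‖) +
          β x' * (κ * (‖y'‖ - ‖y‖)) / ((1 + κ * ‖y‖) * (1 + κ * ‖y'‖)) := by
      field_simp
      ring
    simp only [Function.uncurry_apply_pair, Real.dist_eq, NNReal.coe_add, NNReal.coe_one,
      Real.coe_toNNReal κ hκ]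
    rw [hsplit, add_mul 1 κ, one_mul]
    refine (abs_add_le _ _).trans (add_le_add ?_ ?_)
    · rw [abs_div, abs_of_pos (by linarith : (0 : ℝ) < 1 + κ * ‖y‖)]
      exact (div_le_self (abs_nonneg _) hp).trans h1
    · rw [abs_div, abs_of_pos (by positivity : (0 : ℝ) < (1 + κ * ‖y‖) * (1 + κ * ‖y'‖)), abs_mul,
        abs_mul, abs_of_nonneg (hβ0 x'), abs_of_nonneg hκ]
      refine (div_le_self (by have := hβ0 x'; positivity)
        (one_le_mul_of_one_le_of_one_le hp hp')).trans ?_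
      calc β x' * (κ * |‖y'‖ - ‖y‖|) ≤ 1 * (κ * dist (x, y) (x', y')) :=
            mul_le_mul (hβ1 x') (by gcongr) (by positivity) zero_le_one
        _ = _ := one_mul _
  exact hL.locallyLipschitz

end Gain

/-! ### The main theorem -/

theorem theorem2 {n m p : ℕ}
    -- the system `x' = A(u) x + B(u)`, `y = C x`, and the state feedback law `λ`
    (A : (Fin m → ℝ) → Matrix (Fin n) (Fin n) ℝ) (hA : Continuous A)
    (B : (Fin m → ℝ) → (Fin n → ℝ)) (hB : Continuous B)
    (C : Matrix (Fin p) (Fin n) ℝ)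
    (lam : (Fin n → ℝ) → (Fin m → ℝ)) (hlam : Continuous lam) (hlam0 : lam 0 = 0)
    -- standing assumption: well-posedness of the observer for all constant gains
    (hwp : ∀ a : ℝ, 0 < a → ∀ Q : Matrix (Fin n) (Fin n) ℝ, Q.PosDef →
      HasUniqueGlobalSolutions (observerField A B C lam Q (fun _ _ => a)))
    -- state feedback stabilizability
    (D : Set (Fin n → ℝ)) (hDne : D.Nonempty) (hDopen : IsOpen D)
    (hstab : IsAsymptoticallyStable (feedbackField A B lam) 0)
    (hbasin : basinOfAttraction (feedbackField A B lam) 0 = D)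
    -- dissipativity
    (P : Matrix (Fin n) (Fin n) ℝ) (hP : P.PosDef)
    (hdiss : ∀ x : Fin n → ℝ, ∀ xhat ∈ D, x ⬝ᵥ ((P * A (lam xhat)) *ᵥ x) ≤ 0)
    -- target detectability
    (hdet : IsDetectablePair C (A 0)) :
    ∃ α : (Fin n → ℝ) → (Fin p → ℝ) → ℝ,
      LocallyLipschitz (Function.uncurry α) ∧
      (∀ xhat y, 0 ≤ α xhat y) ∧
      (∀ xhat ∈ D, ∀ y, 0 < α xhat y) ∧
      IsAsymptoticallyStable (observerField A B C lam P α) (0, 0) ∧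
      D ×ˢ (univ : Set (Fin n → ℝ)) ⊆
        basinOfAttraction (observerField A B C lam P α) (0, 0) := by
  subst hbasin
  have hfc := continuous_feedbackField hA hB hlam
  have hu : HasForwardUniqueness (feedbackField A B lam) :=
    hasForwardUniqueness_feedbackField (hwp 1 one_pos P hP)
  obtain ⟨β, hβL, hβ0, hβ1, hβpos, hβM⟩ := exists_robust_error_bound hfc hu hstab hDopen
  obtain ⟨κ, hκ0, hκ⟩ := exists_norm_mulVec_le (P⁻¹ * Cᵀ)
  obtain ⟨κ', hκ'0, hκ'⟩ := exists_norm_mulVec_le C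
  obtain ⟨c, hc, hcV⟩ := hP.exists_sq_norm_le
  let α : (Fin n → ℝ) → (Fin p → ℝ) → ℝ := fun x y => β x / (1 + κ * ‖y‖)
  have hden : ∀ y : Fin p → ℝ, 0 < 1 + κ * ‖y‖ := fun y => by positivity
  have hα0 : ∀ x y, 0 ≤ α x y := fun x y => div_nonneg (hβ0 x) (hden y).le
  have hαpos : ∀ x ∈ basinOfAttraction (feedbackField A B lam) 0, ∀ y, 0 < α x y :=
    fun x hx y => div_pos (hβpos x hx) (hden y)
  have hαL : LocallyLipschitz (Function.uncurry α) :=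
    locallyLipschitz_normalized_gain hβL hβ0 hβ1 hκ0
  have hαβ : ∀ x ε, ‖α x (C *ᵥ ε) • ((P⁻¹ * Cᵀ * C) *ᵥ ε)‖ ≤
      β x / (1 + κ * ‖C *ᵥ ε‖) * (κ * ‖C *ᵥ ε‖) := by
    intro x ε
    rw [norm_smul, Real.norm_of_nonneg (hα0 _ _), ← Matrix.mulVec_mulVec]
    exact mul_le_mul_of_nonneg_left (hκ _) (hα0 _ _)
  -- This bound confines `x̂` whatever the size of `ε`; the next one, which vanishes with the
  -- output, serves convergence and stability.
  have hpβ : ∀ x ε, ‖α x (C *ᵥ ε) • ((P⁻¹ * Cᵀ * C) *ᵥ ε)‖ ≤ β x := by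
    intro x ε
    refine (hαβ x ε).trans ?_
    rw [div_mul_eq_mul_div, div_le_iff₀ (hden _)]
    exact mul_le_mul_of_nonneg_left (by linarith) (hβ0 x)
  have hpκ : ∀ x ε, ‖α x (C *ᵥ ε) • ((P⁻¹ * Cᵀ * C) *ᵥ ε)‖ ≤ κ * ‖C *ᵥ ε‖ := by
    intro x ε
    refine (hαβ x ε).trans (mul_le_of_le_one_left (by positivity) ?_)
    rw [div_le_one (hden _)]
    have : 0 ≤ κ * ‖C *ᵥ ε‖ := by positivity
    linarith [hβ1 x]
  have hFc := continuous_observerField (C := C) (P := P) hA hB hlam hαL.continuous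
  have hV : ∀ z : ℝ → (Fin n → ℝ) × (Fin n → ℝ), ∀ b, 0 ≤ b →
      IsSolutionOn (observerField A B C lam P α) (Icc 0 b) z →
      (z 0).1 ∈ basinOfAttraction (feedbackField A B lam) 0 →
      c * ‖(z b).2‖ ^ 2 ≤ (z 0).2 ⬝ᵥ (P *ᵥ (z 0).2) := by
    intro z b hb hz hz0
    obtain ⟨M, hMD, -, hM⟩ := hβM _ hz0
    refine (hcV _).trans (observer_lyapunov_le hP hα0 hb hz fun t ht => hdiss _ _ (hMD ?_))
    exact hM _ t ht.1 (observer_isApproxSolOn (hz.mono (Icc_subset_Icc_right ht.2))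
      fun s _ => hpβ _ _) rfl
  have hsub : basinOfAttraction (feedbackField A B lam) 0 ×ˢ (univ : Set (Fin n → ℝ)) ⊆
      basinOfAttraction (observerField A B C lam P α) (0, 0) := by
    rintro ⟨x₀, ε₀⟩ ⟨hx₀, -⟩
    obtain ⟨M, hMD, hMc, hM⟩ := hβM x₀ hx₀
    set r : ℝ := √(ε₀ ⬝ᵥ (P *ᵥ ε₀) / c)
    have hbound : ∀ z : ℝ → (Fin n → ℝ) × (Fin n → ℝ), ∀ b, 0 ≤ b →
        IsSolutionOn (observerField A B C lam P α) (Icc 0 b) z → z 0 = (x₀, ε₀) →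
        (z b).1 ∈ M ∧ ‖(z b).2‖ ≤ r := by
      intro z b hb hz hz0
      refine ⟨hM (fun t => (z t).1) b hb (observer_isApproxSolOn hz fun s _ => hpβ _ _)
        (by simp [hz0]), Real.le_sqrt_of_sq_le ?_⟩
      have := hV z b hb hz (by rw [hz0]; exact hx₀)
      rw [hz0] at this
      rw [le_div_iff₀ hc, mul_comm]
      exact this
    obtain ⟨R, hR⟩ := hMc.isBounded.exists_norm_le
    obtain ⟨h1, h2⟩ := exists_global_of_bounded hFc (z₀ := (x₀, ε₀))
      (ρ := max ‖(x₀, ε₀)‖ (max R r)) (le_max_left _ _) (fun T _ z hz hz0 t ht => by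
        obtain ⟨hzM, hzr⟩ := hbound z t ht.1
          (hz.mono fun s hs => ⟨hs.1, hs.2.trans_lt ht.2⟩) hz0
        exact (max_le_max (hR _ hzM) hzr).trans (le_max_right _ _))
    refine ⟨h1, h2, fun z hz hz0 => ?_⟩
    have hb := fun t (ht : 0 ≤ t) => hbound z t ht (hz.mono Icc_subset_Ici_self) hz0
    exact observer_tendsto hA hB hlam hlam0 hu hstab hP hdet hαL.continuous hα0 hpκ hMc hMD
      (fun x xhat hx => hdiss x xhat (hMD hx)) (fun x hx => hαpos x (hMD hx)) hz
      (fun t ht => (hb t ht).1) (fun t ht => (hb t ht).2)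
  refine ⟨α, hαL, hα0, hαpos, ⟨⟨?_, fun U hU => ?_⟩, ?_⟩, hsub⟩
  · have h0 : feedbackField A B lam 0 = 0 := hstab.1.1
    simp only [feedbackField, Matrix.mulVec_zero] at h0
    simp only [observerField, Matrix.mulVec_zero, smul_zero, sub_zero]
    rw [h0]
    rfl
  · obtain ⟨U₁, hU₁, U₂, hU₂, hU₁₂⟩ := mem_nhds_prod_iff.mp hU
    obtain ⟨r, hr, hrU⟩ := Metric.nhds_basis_closedBall.mem_iff.mp hU₂
    obtain ⟨K, hK, δ, hδ, H⟩ := exists_stable_of_approx hfc hu hstab hU₁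
    -- If `‖ε‖ ≤ ρ`, then `ε` lies in `U₂` and the correction is at most `κ * κ' * ρ ≤ δ`, the error
    -- tolerated near the equilibrium. The sublevel `c * ρ ^ 2` of `V` keeps `ε` in this ball.
    set ρ : ℝ := min r (δ / (κ * κ' + 1)) with hρ
    have hρ0 : 0 < ρ := lt_min hr (by positivity)
    have hρδ : κ * (κ' * ρ) ≤ δ := by
      have h1 : ρ * (κ * κ' + 1) ≤ δ := (le_div_iff₀ (by positivity)).mp (min_le_right _ _)
      nlinarith
    have hVsmall : {ε : Fin n → ℝ | ε ⬝ᵥ (P *ᵥ ε) < c * ρ ^ 2} ∈ 𝓝 (0 : Fin n → ℝ) := by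
      refine (continuous_quadraticForm P).continuousAt.preimage_mem_nhds (Iio_mem_nhds ?_)
      rw [zero_dotProduct]
      positivity
    refine ⟨(K ∩ basinOfAttraction (feedbackField A B lam) 0) ×ˢ
      {ε : Fin n → ℝ | ε ⬝ᵥ (P *ᵥ ε) < c * ρ ^ 2},
      prod_mem_nhds (inter_mem hK hstab.2) hVsmall, fun T _ z hz hz0 t ht => hU₁₂ ?_⟩
    have hzt : IsSolutionOn (observerField A B C lam P α) (Icc 0 t) z :=
      hz.mono fun s hs => ⟨hs.1, hs.2.trans_lt ht.2⟩
    have hερ : ∀ s ∈ Icc 0 t, ‖(z s).2‖ ≤ ρ := by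
      intro s hs
      have h1 := hV z s hs.1 (hzt.mono (Icc_subset_Icc_right hs.2)) hz0.1.2
      have h2 : (z 0).2 ⬝ᵥ (P *ᵥ (z 0).2) < c * ρ ^ 2 := hz0.2
      have h3 : ‖(z s).2‖ ^ 2 ≤ ρ ^ 2 := (mul_lt_mul_iff_right₀ hc).mp (h1.trans_lt h2) |>.le
      exact le_of_sq_le_sq h3 hρ0.le
    refine ⟨H (fun s => (z s).1) t ht.1 (observer_isApproxSolOn hzt fun s hs => ?_) hz0.1.1,
      hrU ?_⟩
    · refine (hpκ _ _).trans (le_trans ?_ hρδ)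
      exact mul_le_mul_of_nonneg_left ((hκ' _).trans
        (mul_le_mul_of_nonneg_left (hερ s hs) hκ'0)) hκ0
    · rw [mem_closedBall_zero_iff]
      exact (hερ t ⟨ht.1, le_rfl⟩).trans (min_le_left _ _)
  · exact mem_of_superset (prod_mem_nhds hstab.2 univ_mem) hsub
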